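/- Let $0<q<1$, $d\ge 2$ and $\boldsymbol\alpha=(\alpha_1,\dots,\alpha_d)$ with all $\alpha_i>0$. For $\alpha>0$ let $V^{(\alpha)}$ be the complex inner product space with orthonormal (algebraic) basis $e_n^{(\alpha)}$, $n\ge 0$, and operators $$A_0e_n=\bigl(n+\tfrac{\alpha+1}{2}\bigr)e_n,\quad A_+e_n=\sqrt{\sigma_{n+1}}\,e_{n+1},\quad A_-e_n=\sqrt{\sigma_n}\,e_{n-1},\qquad \sigma_n=q^{1/2}\frac{(1-q^n)(1-q^{n+\alpha})}{(1-q)^2}.$$ Let $W=V^{(\alpha_1)}\otimes\cdots\otimes V^{(\alpha_d)}$ (algebraic tensor product) with orthonormal basis $e_{\mathbf y}=e_{y_1}^{(\alpha_1)}\otimes\cdots\otimes e_{y_d}^{(\alpha_d)}$, $\mathbf y\in\mathbb Z_{\ge0}^d$. Let $A_0^{(k)},A_\pm^{(k)}$ be $A_0,A_\pm$ acting on the $k$-th factor, and for $1\le i<j\le d$ put $$A_0^{[i;j]}=\sum_{k=i}^jA_0^{(k)},\qquad A_\pm^{[i;j]}=\sum_{k=i}^j q^{\sum_{\ell=i}^{k-1}A_0^{(\ell)}}A_\pm^{(k)},$$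 $$\Gamma^{[i;j]}=\frac{q^{-1/2}q^{A_0^{[i;j]}}+q^{1/2}q^{-A_0^{[i;j]}}}{(q^{1/2}-q^{-1/2})^2}-A_+^{[i;j]}A_-^{[i;j]}q^{1-A_0^{[i;j]}},\qquad \gamma(a)=\frac{q^{a/2}+q^{-a/2}}{(q^{1/2}-q^{-1/2})^2}.$$ With $(a;q)_n=\prod_{i=0}^{n-1}(1-aq^i)$ and integers $0\le x\le N$, $0\le n\le N$, let $\widehat h_n(x,\alpha,\beta,N;q)=\sqrt{\omega/\eta}\;h_n$, where $$h_n=(q^{\alpha+1};q)_n(q^{-N};q)_n\;{}_3\phi_2\!\left(\begin{matrix}q^{-n},\,q^{n+\alpha+\beta+1},\,q^{-x}\\ q^{\alpha+1},\,q^{-N}\end{matrix};q,q\right),\qquad \omega=\frac{(q^{\alpha+1};q)_x(q^{\beta+1};q)_{N-x}}{(q;q)_x(q;q)_{N-x}}q^{(N-x)(\alpha+1)},$$ $$\eta=\frac{(q^{\alpha+\beta+2};q)_{n+N}}{(q;q)_{N-n}}\,q^{2\binom n2-2Nn}\,\frac{1-q^{\alpha+\beta+1}}{1-q^{2n+\alpha+\beta+1}}\,\frac{(q;q)_n(q^{\alpha+1};q)_n(q^{\beta+1};q)_n}{(q^{\alpha+\beta+1};q)_n}\,q^{n(\alpha+1)},$$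 and let $\widehat h_n(x,\alpha,\beta,N;q)=0$ for all other integers $x,N$ and $n\ge0$. For $\mathbf m,\mathbf y\in\mathbb Z_{\ge0}^d$ write $M_k=\sum_{i=1}^km_i$, $Y_k=\sum_{i=1}^ky_i$, $A_k=\sum_{i=1}^k\alpha_i$, $\widetilde Y_k=\sum_{i=2}^ky_i$, $\widetilde A_k=\sum_{i=2}^k\alpha_i$, and define $$\Xi_{\mathbf m}(\mathbf y)=\delta_{M_dY_d}\prod_{k=1}^{d-2}\widehat h_{m_k}\bigl(\widetilde Y_{k+1}-M_{k-1},\,2M_{k-1}+\widetilde A_{k+1}+k-1,\,\alpha_{k+2},\,\widetilde Y_{k+2}-M_{k-1};q\bigr)$$ $$\times\;\widehat h_{m_{d-1}}\bigl(y_1,\,\alpha_1,\,2M_{d-2}+\widetilde A_d+d-2,\,Y_d-M_{d-2};q\bigr).$$ Then, all sums having only finitely many non-zero terms, $$\sum_{\mathbf y}\Xi_{\mathbf m}(\mathbf y)\,\Xi_{\mathbf m'}(\mathbf y)=\delta_{\mathbf m\mathbf m'},\qquad \sum_{\mathbf m}\Xi_{\mathbf m}(\mathbf y)\,\Xi_{\mathbf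 m}(\mathbf y')=\delta_{\mathbf y\mathbf y'}.$$ Moreover there is an orthonormal basis $(u_{\mathbf m})$ of $W$ satisfying the joint eigenvalue equations $$\Gamma^{[2;k]}u_{\mathbf m}=\gamma(2M_{k-2}+\widetilde A_k+k-2)\,u_{\mathbf m}\quad(3\le k\le d),$$ $$\Gamma^{[1;d]}u_{\mathbf m}=\gamma(2M_{d-1}+A_d+d-1)\,u_{\mathbf m},\qquad q^{A_0^{[1;d]}}u_{\mathbf m}=q^{M_d+(A_d+d)/2}\,u_{\mathbf m},$$ which these equations determine up to multiplying each $u_{\mathbf m}$ by a phase, and, with a suitable choice of the phases, $$u_{\mathbf m}=\sum_{\mathbf y}\Xi_{\mathbf m}(\mathbf y)\,e_{\mathbf y},\qquad e_{\mathbf y}=\sum_{\mathbf m}\Xi_{\mathbf m}(\mathbf y)\,u_{\mathbf m}.$$ -/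

import Mathlib

open scoped TensorProduct

noncomputable section

namespace SUq

/-! ### Indexing: multi-indices are functions on `Fin d`, written with labels `1, …, d` -/

/-- The entry `x_k` of `x = (x_1, …, x_d)`, for `1 ≤ k ≤ d` (and `0` for any other label). -/
def entry {R : Type*} [Zero R] {d : ℕ} (x : Fin d → R) (k : ℕ) : R :=
  if h : 1 ≤ k ∧ k ≤ d then x ⟨k - 1, by omega⟩ else 0

/-- The partial sum `x_i + x_{i+1} + ⋯ + x_j` (zero if `j < i`). -/
def psum {R : Type*} [AddCommMonoid R] {d : ℕ} (x : Fin d → R) (i j : ℕ) : R :=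
  ∑ k ∈ Finset.Icc i j, entry x k

/-- The set `[i;j] = {i, …, j}` of tensor factors; the factor with label `k` is `k - 1 : Fin d`. -/
def interval (d i j : ℕ) : Finset (Fin d) :=
  Finset.univ.filter fun k => i ≤ (k : ℕ) + 1 ∧ (k : ℕ) + 1 ≤ j

/-! ### The univariate `q`-Hahn functions -/

/-- The `q`-Pochhammer symbol `(a;q)_n`. -/
def qPoch (a q : ℝ) (n : ℕ) : ℝ := ∏ i ∈ Finset.range n, (1 - a * q ^ i)

/-- The basic hypergeometric series `₃φ₂(a₁, a₂, a₃; b₁, b₂; q, z)`. -/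
def phi32 (a₁ a₂ a₃ b₁ b₂ q z : ℝ) : ℝ :=
  ∑' k : ℕ, (qPoch a₁ q k * qPoch a₂ q k * qPoch a₃ q k) /
    (qPoch q q k * qPoch b₁ q k * qPoch b₂ q k) * z ^ k

/-- The `q`-Hahn polynomial `h_n(x, α, β, N; q)`, for `0 ≤ n ≤ N`. -/
def qHahn (q : ℝ) (n x : ℕ) (α β : ℝ) (N : ℕ) : ℝ :=
  qPoch (q ^ (α + 1)) q n * qPoch (q ^ (-(N : ℝ))) q n *
    phi32 (q ^ (-(n : ℝ))) (q ^ ((n : ℝ) + α + β + 1)) (q ^ (-(x : ℝ)))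
      (q ^ (α + 1)) (q ^ (-(N : ℝ))) q q

/-- The weight `ω(x; α, β, N; q)`, for `0 ≤ x ≤ N`. -/
def omega (q : ℝ) (x : ℕ) (α β : ℝ) (N : ℕ) : ℝ :=
  (qPoch (q ^ (α + 1)) q x * qPoch (q ^ (β + 1)) q (N - x)) / (qPoch q q x * qPoch q q (N - x)) *
    q ^ (((N : ℝ) - x) * (α + 1))

/-- The normalization `η(n, α, β, N; q)`, for `0 ≤ n ≤ N`. -/
def eta (q : ℝ) (n : ℕ) (α β : ℝ) (N : ℕ) : ℝ :=
  qPoch (q ^ (α + β + 2)) q (n + N) / qPoch q q (N - n) *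
    q ^ (2 * (n.choose 2 : ℝ) - 2 * (N : ℝ) * n) *
    ((1 - q ^ (α + β + 1)) / (1 - q ^ (2 * (n : ℝ) + α + β + 1))) *
    ((qPoch q q n * qPoch (q ^ (α + 1)) q n * qPoch (q ^ (β + 1)) q n) /
      qPoch (q ^ (α + β + 1)) q n) *
    q ^ ((n : ℝ) * (α + 1))

/-- The `q`-Hahn function `ĥ_n(x, α, β, N; q) = √(ω / η) h_n`. It lives on `0 ≤ x ≤ N` and
`0 ≤ n ≤ N`, and is zero elsewhere (as the Clebsch–Gordan coefficients are, and in accordance with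
`1 / (q;q)_{-k} = 0` for `k ≥ 1`). -/
def qHahnHat (q : ℝ) (n : ℕ) (x : ℤ) (α β : ℝ) (N : ℤ) : ℝ :=
  if 0 ≤ x ∧ x ≤ N ∧ (n : ℤ) ≤ N then
    Real.sqrt (omega q x.toNat α β N.toNat / eta q n α β N.toNat) *
      qHahn q n x.toNat α β N.toNat
  else 0

/-- The function `Ξ_m^{(α)}(y)`. -/
def Xi {d : ℕ} (q : ℝ) (α : Fin d → ℝ) (m y : Fin d → ℕ) : ℝ :=
  let M : ℕ → ℕ := psum m 1
  let Y : ℕ → ℕ := psum y 1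
  let Yt : ℕ → ℕ := psum y 2
  let At : ℕ → ℝ := psum α 2
  (if M d = Y d then 1 else 0) *
    (∏ k ∈ Finset.Icc 1 (d - 2),
      qHahnHat q (entry m k) ((Yt (k + 1) : ℤ) - M (k - 1))
        (2 * (M (k - 1) : ℝ) + At (k + 1) + k - 1) (entry α (k + 2))
        ((Yt (k + 2) : ℤ) - M (k - 1))) *
    qHahnHat q (entry m (d - 1)) ((entry y 1 : ℕ) : ℤ)
      (entry α 1) (2 * (M (d - 2) : ℝ) + At d + d - 2)
      ((Y d : ℤ) - M (d - 2))

/-! ### Positive-discrete series representations of `su_q(1,1)` -/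

/-- The underlying space of `V^{(α)}`: the complex vector space with basis `e_0, e_1, …`. -/
def V : Type := ℕ →₀ ℂ

instance : AddCommGroup V := inferInstanceAs (AddCommGroup (ℕ →₀ ℂ))

instance : Module ℂ V := inferInstanceAs (Module ℂ (ℕ →₀ ℂ))

/-- The basis `e_0, e_1, …` of `V^{(α)}`. -/
def eV : Module.Basis ℕ ℂ V := (Finsupp.basisSingleOne : Module.Basis ℕ ℂ (ℕ →₀ ℂ))

/-- The matrix elements `σ_n^{(α)}`. -/
def sigma (q α : ℝ) (n : ℕ) : ℝ :=
  q ^ (1 / 2 : ℝ) * ((1 - q ^ n) * (1 - q ^ ((n : ℝ) + α))) / (1 - q) ^ 2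

/-- The operator `q^{s A_0}` on `V^{(α)}`: since `A_0 e_n = (n + (α + 1) / 2) e_n`, it acts by
`e_n ↦ q^{s (n + (α + 1) / 2)} e_n`. -/
def qA0 (q s α : ℝ) : Module.End ℂ V :=
  eV.constr ℂ fun n : ℕ =>
    ((q ^ (s * ((n : ℝ) + (α + 1) / 2)) : ℝ) : ℂ) • eV n

/-- The operator `A_+` on `V^{(α)}`: `e_n ↦ √σ_{n+1} e_{n+1}`. -/
def Aplus (q α : ℝ) : Module.End ℂ V :=
  eV.constr ℂ fun n : ℕ =>
    ((Real.sqrt (sigma q α (n + 1)) : ℝ) : ℂ) • eV (n + 1)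

/-- The operator `A_-` on `V^{(α)}`: `e_n ↦ √σ_n e_{n-1}`, where `σ_0 = 0`. -/
def Aminus (q α : ℝ) : Module.End ℂ V :=
  eV.constr ℂ fun n : ℕ =>
    ((Real.sqrt (sigma q α n) : ℝ) : ℂ) • eV (n - 1)

/-- The underlying space of `W^{(α)} = V^{(α_1)} ⊗ ⋯ ⊗ V^{(α_d)}`. -/
abbrev W (d : ℕ) : Type := ⨂[ℂ] _ : Fin d, V

/-- The direct-product basis `e_y = e_{y_1} ⊗ ⋯ ⊗ e_{y_d}`, as a basis of `W`. -/
def e (d : ℕ) : Module.Basis (Fin d → ℕ) ℂ (W d) :=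
  Basis.piTensorProduct fun _ : Fin d => eV

theorem e_apply {d : ℕ} (y : Fin d → ℕ) :
    e d y = PiTensorProduct.tprod ℂ fun k => eV (y k) := by
  simp [e]

/-- The inner product on `W` (conjugate-linear in the first argument) with
`⟨e_y, e_{y'}⟩ = δ_{y y'}`. -/
def ip {d : ℕ} (v w : W d) : ℂ :=
  ((e d).repr v).sum fun y c => (starRingEnd ℂ) c * (e d).repr w y

/-- The operator `1 ⊗ ⋯ ⊗ A ⊗ ⋯ ⊗ 1` acting by `A` on the factor `k`. -/
def site {d : ℕ} (k : Fin d) (A : Module.End ℂ V) : Module.End ℂ (W d) :=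
  PiTensorProduct.map fun l => if l = k then A else LinearMap.id

/-- The operator `q^{s A_0^S}`, `A_0^S = ∑_{k ∈ S} A_0^{(k)}`: the tensor product of the operators
`q^{s A_0}` on the factors in `S` and of the identity on the others. -/
def qA0Set {d : ℕ} (q s : ℝ) (α : Fin d → ℝ) (S : Finset (Fin d)) : Module.End ℂ (W d) :=
  PiTensorProduct.map fun l => if l ∈ S then qA0 q s (α l) else LinearMap.id

/-- `A_+^{[i;j]} = ∑_{k=i}^{j} q^{A_0^{(i)} + ⋯ + A_0^{(k-1)}} A_+^{(k)}`. -/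
def AplusSet {d : ℕ} (q : ℝ) (α : Fin d → ℝ) (i j : ℕ) : Module.End ℂ (W d) :=
  ∑ k ∈ interval d i j, qA0Set q 1 α (interval d i k) * site k (Aplus q (α k))

/-- `A_-^{[i;j]} = ∑_{k=i}^{j} q^{A_0^{(i)} + ⋯ + A_0^{(k-1)}} A_-^{(k)}`. -/
def AminusSet {d : ℕ} (q : ℝ) (α : Fin d → ℝ) (i j : ℕ) : Module.End ℂ (W d) :=
  ∑ k ∈ interval d i j, qA0Set q 1 α (interval d i k) * site k (Aminus q (α k))

/-- The intermediate Casimir operator `Γ^{[i;j]}`, equal to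
`(q^{-1/2} q^{A_0} + q^{1/2} q^{-A_0}) / (q^{1/2} - q^{-1/2})^2 - A_+ A_- q^{1 - A_0}`
in the generators attached to `[i;j]`. -/
def Casimir {d : ℕ} (q : ℝ) (α : Fin d → ℝ) (i j : ℕ) : Module.End ℂ (W d) :=
  (((q ^ (1 / 2 : ℝ) - q ^ (-1 / 2 : ℝ)) ^ 2 : ℝ) : ℂ)⁻¹ •
      (((q ^ (-1 / 2 : ℝ) : ℝ) : ℂ) • qA0Set q 1 α (interval d i j) +
        ((q ^ (1 / 2 : ℝ) : ℝ) : ℂ) • qA0Set q (-1) α (interval d i j)) -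
    AplusSet q α i j * AminusSet q α i j * ((q : ℂ) • qA0Set q (-1) α (interval d i j))

/-- The Casimir eigenvalue `γ(a)` of `V^{(a)}`. -/
def gamma (q a : ℝ) : ℝ :=
  (q ^ (a / 2) + q ^ (-a / 2)) / (q ^ (1 / 2 : ℝ) - q ^ (-1 / 2 : ℝ)) ^ 2

/-! ### The coupled basis -/

/-- The joint eigenvalue equations of `Γ^{[2;3]}, …, Γ^{[2;d]}, Γ^{[1;d]}, q^{A_0^{[1;d]}}` with
the eigenvalues labelled by the multi-index `m`. -/
structure JointEigen {d : ℕ} (q : ℝ) (α : Fin d → ℝ) (m : Fin d → ℕ) (w : W d) : Prop where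
  intermediate : ∀ k : ℕ, 3 ≤ k → k ≤ d →
    Casimir q α 2 k w =
      ((gamma q (2 * ((psum m 1 (k - 2) : ℕ) : ℝ) + psum α 2 k + k - 2) : ℝ) : ℂ) • w
  full : Casimir q α 1 d w =
      ((gamma q (2 * ((psum m 1 (d - 1) : ℕ) : ℝ) + psum α 1 d + d - 1) : ℝ) : ℂ) • w
  weight : qA0Set q 1 α (interval d 1 d) w =
      ((q ^ (((psum m 1 d : ℕ) : ℝ) + (psum α 1 d + d) / 2) : ℝ) : ℂ) • w

/-- `u` is an orthonormal basis of `W` whose members satisfy the joint eigenvalue equations. -/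
structure IsCoupledBasis {d : ℕ} (q : ℝ) (α : Fin d → ℝ) (u : (Fin d → ℕ) → W d) : Prop where
  orthonormal : ∀ m m' : Fin d → ℕ, ip (u m) (u m') = if m = m' then 1 else 0
  span : Submodule.span ℂ (Set.range u) = ⊤
  eigen : ∀ m : Fin d → ℕ, JointEigen q α m (u m)

end SUq

end

noncomputable section

namespace SUq

open Finset.HasAntidiagonal (antidiagonal mem_antidiagonal)
open Function (update)

/-! ### The `q`-Pochhammer symbol -/

/-! The functions `qHahnHat` are the Clebsch–Gordan coefficients of `su_q(1,1)`, and `Xi` is a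
product of `d - 1` of them. Everything rests on two contiguous relations for the `q`-Hahn
polynomials, `hahnPoly_raise` and `hahnPoly_lower`. After normalization (`qHahnHat_raise`,
`qHahnHat_lower`) they say that, for families of types `a` and `b`, the vector `∑ ĥ_n(x, a, b, n +
r) e_x ⊗ e_z` over `x + z = n + r` moves under the coproducts of `A_±` exactly like the vector of
level `r` in the representation of type `a + b + 1 + 2n`.

The same relations give orthonormality of the `q`-Hahn functions. The coproducts of `A_+` and `A_-`
are mutually adjoint, so an inner product at level `N + 1` reduces to one at level `N`
(`sum_qHahnHat_succ`). The induction bottoms out at the lowest weight vectors `n = N`, where the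
recurrence in `x` has order one and the norm is a `q`-Vandermonde sum (`sum_qHahnHat_top`).

The multivariate statement iterates one step. A `Ladder` is a family of vectors on which four
operators act as in some `V^{(a)}` at one label, with `a` allowed to depend on the other labels.
Coupling two ladders yields a ladder for the coproduct (`Ladder.couple`), preserves orthonormality
(`IsOrthonormal.couple`) and does not disturb operators acting at other labels. The factors `3, …,
d` are coupled one after another to factor `2`, and finally factor `1` is coupled from the left to
`[2;d]`. The Casimir of a ladder is the scalar `gamma` of its type, and the type of a block is
untouched by later couplings; this gives the joint eigenvalue equations. Each coupling sum
contributes at most one term to a given coefficient, so the coefficients of the final basis are the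
products `Xi` (`repr_coupled`).

Orthonormality of the coupled vectors is the first orthogonality relation. Since `Xi` preserves
total degree, it splits into finite square matrices, for which orthonormal rows imply orthonormal
columns; this is the second relation and also gives completeness. Uniqueness holds because `gamma`
is injective on positive arguments, so the joint eigenvalues determine all partial sums of `m` and
every joint eigenspace is a line. -/

@[simp]
theorem qPoch_zero (a q : ℝ) : qPoch a q 0 = 1 := by simp [qPoch]

theorem qPoch_succ (a q : ℝ) (n : ℕ) : qPoch a q (n + 1) = qPoch a q n * (1 - a * q ^ n) := by
  simp [qPoch, Finset.prod_range_succ]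

theorem qPoch_succ' (a q : ℝ) (n : ℕ) : qPoch a q (n + 1) = (1 - a) * qPoch (a * q) q n := by
  simp only [qPoch, Finset.prod_range_succ', pow_zero, mul_one]
  rw [mul_comm]
  congr 1
  exact Finset.prod_congr rfl fun i _ => by ring

theorem one_sub_mul_qPoch (a q : ℝ) (n : ℕ) :
    (1 - a) * qPoch (a * q) q n = qPoch a q n * (1 - a * q ^ n) := by
  rw [← qPoch_succ', qPoch_succ]

theorem qPoch_add (a q : ℝ) (m n : ℕ) :
    qPoch a q (m + n) = qPoch a q m * qPoch (a * q ^ m) q n := by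
  simp only [qPoch, Finset.prod_range_add]
  congr 1
  exact Finset.prod_congr rfl fun i _ => by ring

theorem qPoch_eq_mul_tail (a q : ℝ) {k n : ℕ} (h : k ≤ n) :
    qPoch a q n = qPoch a q k * qPoch (a * q ^ k) q (n - k) := by
  rw [← qPoch_add, Nat.add_sub_cancel' h]

theorem qPoch_tail (a q : ℝ) {k n : ℕ} (h : k < n) :
    qPoch (a * q ^ k) q (n - k) = (1 - a * q ^ k) * qPoch (a * q ^ (k + 1)) q (n - (k + 1)) := by
  have : n - k = n - (k + 1) + 1 := by omega
  rw [this, qPoch_succ', pow_succ, mul_assoc]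

theorem qPoch_pos {a q : ℝ} (hq0 : 0 < q) (hq1 : q < 1) (ha : a < 1) (n : ℕ) :
    0 < qPoch a q n := by
  refine Finset.prod_pos fun i _ => ?_
  have h1 : q ^ i ≤ 1 := pow_le_one₀ hq0.le hq1.le
  have h2 : 0 < q ^ i := pow_pos hq0 i
  rcases le_or_gt a 0 with h | h
  · nlinarith
  · nlinarith

theorem qPoch_inv_pow_eq_zero {q : ℝ} (hq0 : 0 < q) {n k : ℕ} (h : n < k) :
    qPoch (q ^ n)⁻¹ q k = 0 := by
  refine Finset.prod_eq_zero (Finset.mem_range.2 h) ?_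
  rw [inv_mul_cancel₀ (pow_pos hq0 n).ne', sub_self]

theorem qPoch_inv_pow_ne_zero {q : ℝ} (hq0 : 0 < q) (hq1 : q < 1) {n k : ℕ} (h : k ≤ n) :
    qPoch (q ^ n)⁻¹ q k ≠ 0 := by
  refine Finset.prod_ne_zero_iff.2 fun i hi => ?_
  have hi : i < n := lt_of_lt_of_le (Finset.mem_range.1 hi) h
  have h1 : q ^ n < q ^ i := pow_lt_pow_right_of_lt_one₀ hq0 hq1 hi
  have h2 : 0 < q ^ n := pow_pos hq0 n
  have : 1 < (q ^ n)⁻¹ * q ^ i := by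
    rw [inv_mul_eq_div, one_lt_div h2]
    exact h1
  linarith

/-- Reversing the product gives `(q^{-n};q)_n = (-1)^n q^{-n(n+1)/2} (q;q)_n`; squaring removes the
sign and the halved exponent. -/
theorem qPoch_inv_pow_self {q : ℝ} (hq0 : 0 < q) (n : ℕ) :
    qPoch (q ^ n)⁻¹ q n ^ 2 * q ^ (n * (n + 1)) = qPoch q q n ^ 2 := by
  induction n with
  | zero => simp
  | succ n ih =>
    have hq : q ≠ 0 := hq0.ne'
    have h1 : qPoch (q ^ (n + 1))⁻¹ q (n + 1) = (1 - (q ^ (n + 1))⁻¹) * qPoch (q ^ n)⁻¹ q n := by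
      rw [qPoch_succ']
      congr 2
      field_simp
      ring
    have h2 : q ^ ((n + 1) * (n + 1 + 1)) = q ^ (n * (n + 1)) * (q ^ (n + 1)) ^ 2 := by ring
    have h3 : (1 - (q ^ (n + 1))⁻¹) * q ^ (n + 1) = q ^ (n + 1) - 1 := by
      field_simp
    rw [h1, h2, qPoch_succ q q n]
    calc _ = (qPoch (q ^ n)⁻¹ q n ^ 2 * q ^ (n * (n + 1))) *
          ((1 - (q ^ (n + 1))⁻¹) * q ^ (n + 1)) ^ 2 := by ring
      _ = _ := by rw [ih, h3]; ring

/-! ### The `q`-Hahn polynomials as finite sums -/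

/-- The coefficient of `(U;q)_k` in the `q`-Hahn polynomial, where `A = q^{α+1}`, `B = q^{β+1}`,
`U = q^{-x}` and `ν = q^{-N}`. -/
def hahnCoeff (q A B ν : ℝ) (n k : ℕ) : ℝ :=
  qPoch (A * q ^ k) q (n - k) * qPoch (ν * q ^ k) q (n - k) * qPoch (q ^ n)⁻¹ q k *
    qPoch (q ^ n * (A * B / q)) q k / qPoch q q k * q ^ k

/-- The `q`-Hahn polynomial, as a polynomial in `U = q^{-x}` and `ν = q^{-N}`. -/
def hahnPoly (q A B U ν : ℝ) (n : ℕ) : ℝ :=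
  ∑ k ∈ Finset.range (n + 1), hahnCoeff q A B ν n k * qPoch U q k

theorem rpow_neg_nat {q : ℝ} (hq0 : 0 < q) (n : ℕ) : q ^ (-(n : ℝ)) = (q ^ n)⁻¹ := by
  rw [Real.rpow_neg hq0.le, Real.rpow_natCast]

theorem rpow_add_one_lt_one {q : ℝ} (hq0 : 0 < q) (hq1 : q < 1) {a : ℝ} (ha : 0 < a) :
    q ^ (a + 1) < 1 :=
  Real.rpow_lt_one hq0.le hq1 (by linarith)

/-- The series stops at `k = n` because `(q^{-n};q)_k` vanishes beyond, and the prefactors absorb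
the denominators through `(A;q)_n / (A;q)_k = (A q^k;q)_{n-k}`. The result is polynomial in `ν`,
hence meaningful even at `ν = q^{-(n-1)}`, which the lowering relation reaches at `N = n`. -/
theorem qHahn_eq_hahnPoly {q : ℝ} (hq0 : 0 < q) (hq1 : q < 1) {a b : ℝ} (ha : 0 < a)
    {n N : ℕ} (hn : n ≤ N) (x : ℕ) :
    qHahn q n x a b N =
      hahnPoly q (q ^ (a + 1)) (q ^ (b + 1)) (q ^ x)⁻¹ (q ^ N)⁻¹ n := by
  have hs : q ^ ((n : ℝ) + a + b + 1) = q ^ n * (q ^ (a + 1) * q ^ (b + 1) / q) := by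
    rw [← Real.rpow_natCast, ← Real.rpow_add hq0, ← Real.rpow_sub_one hq0.ne',
      ← Real.rpow_add hq0]
    congr 1
    ring
  unfold qHahn phi32 hahnPoly
  rw [hs]
  simp only [rpow_neg_nat hq0]
  rw [tsum_eq_sum (s := Finset.range (n + 1)), Finset.mul_sum]
  · refine Finset.sum_congr rfl fun k hk => ?_
    have hk : k ≤ n := Nat.lt_succ_iff.1 (Finset.mem_range.1 hk)
    have h1 := (qPoch_pos hq0 hq1 hq1 k).ne'
    have h2 := (qPoch_pos hq0 hq1 (rpow_add_one_lt_one hq0 hq1 ha) k).ne'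
    have h3 := qPoch_inv_pow_ne_zero hq0 hq1 (hk.trans hn)
    rw [qPoch_eq_mul_tail (q ^ (a + 1)) q hk, qPoch_eq_mul_tail (q ^ N)⁻¹ q hk]
    rw [show ∀ u v w z y D E F : ℝ, D ≠ 0 → F ≠ 0 →
        D * u * (F * v) * (w * z * y / (E * D * F) * q ^ k) =
      u * v * w * z / E * q ^ k * y by intros; field_simp]
    · rfl
    · exact h2
    · exact h3
  · intro k hk
    have hk : n < k := by simpa using hk
    rw [qPoch_inv_pow_eq_zero hq0 hk]
    simp

/-- With `V = q^x` and `ν = q^{-N}` this is the unnormalized action of `A_+`, from `N` to `N + 1`.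
It holds term by term: the shift `U ↦ U q` multiplies `(U;q)_k` so that the coefficient becomes `q^k
- q / ν`, and that factor turns `(ν q^k;q)_{n-k}` into its shift by `ν ↦ ν / q`. -/
theorem hahnPoly_raise {q A B U ν V : ℝ} (hq : q ≠ 0) (hν : ν ≠ 0) (hUV : V * U = 1) (n : ℕ) :
    (1 - V) * hahnPoly q A B (U * q) ν n + (V - q / ν) * hahnPoly q A B U ν n =
      (q ^ n - q / ν) * hahnPoly q A B U (ν / q) n := by
  unfold hahnPoly
  simp only [Finset.mul_sum]
  rw [← Finset.sum_add_distrib]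
  refine Finset.sum_congr rfl fun k hk => ?_
  have hk : k ≤ n := Nat.lt_succ_iff.1 (Finset.mem_range.1 hk)
  have h1 : (1 - V) * qPoch (U * q) q k = (q ^ k - V) * qPoch U q k := by
    have := one_sub_mul_qPoch U q k
    linear_combination (-V) * this + (q ^ k * qPoch U q k - qPoch (U * q) q k) * hUV
  have h2 : (q ^ k - q / ν) * qPoch (ν * q ^ k) q (n - k) =
      (q ^ n - q / ν) * qPoch (ν / q * q ^ k) q (n - k) := by
    have := one_sub_mul_qPoch (ν / q * q ^ k) q (n - k)
    have e1 : ν / q * q ^ k * q = ν * q ^ k := by field_simp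
    have e2 : ν / q * q ^ k * q ^ (n - k) = ν / q * q ^ n := by
      rw [mul_assoc, ← pow_add, Nat.add_sub_cancel' hk]
    rw [e1, e2] at this
    have e3 : q ^ k - q / ν = -(q / ν) * (1 - ν / q * q ^ k) := by field_simp; ring
    have e4 : q ^ n - q / ν = -(q / ν) * (1 - ν / q * q ^ n) := by field_simp; ring
    rw [e3, e4, mul_assoc, this]
    ring
  unfold hahnCoeff
  linear_combination (qPoch (A * q ^ k) q (n - k) * qPoch (ν * q ^ k) q (n - k) *
    qPoch (q ^ n)⁻¹ q k * qPoch (q ^ n * (A * B / q)) q k / qPoch q q k * q ^ k) * h1 +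
    (qPoch (A * q ^ k) q (n - k) *
    qPoch (q ^ n)⁻¹ q k * qPoch (q ^ n * (A * B / q)) q k / qPoch q q k * q ^ k * qPoch U q k) * h2

theorem hahnCoeff_succ {q A B ν : ℝ} (hq0 : 0 < q) (hq1 : q < 1) {n k : ℕ} (hk : k < n) :
    hahnCoeff q A B ν n (k + 1) * (1 - q ^ (k + 1)) * (1 - A * q ^ k) * (1 - ν * q ^ k) =
      hahnCoeff q A B ν n k * (1 - (q ^ n)⁻¹ * q ^ k) * (1 - q ^ n * (A * B / q) * q ^ k) * q := by
  have h1 := (qPoch_pos hq0 hq1 hq1 k).ne'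
  have h2 : 1 - q * q ^ k ≠ 0 := by
    have : q ^ (k + 1) < 1 := pow_lt_one₀ hq0.le hq1 (by omega)
    rw [pow_succ'] at this
    linarith
  unfold hahnCoeff
  rw [qPoch_tail A q hk, qPoch_tail ν q hk, qPoch_succ, qPoch_succ, qPoch_succ, pow_succ' q k]
  field_simp

/-- Summation by parts for the shift `U ↦ U / q` in the basis `(U;q)_k`. -/
theorem sum_qPoch_shift {q U V A : ℝ} (hq : q ≠ 0) (hUV : V * U = 1) (c : ℕ → ℝ) (n : ℕ) :
    (1 - A * V) * ∑ k ∈ Finset.range (n + 1), c k * qPoch (U / q) q k +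
        (A * V) * ∑ k ∈ Finset.range (n + 1), c k * qPoch U q k =
      (∑ k ∈ Finset.range (n + 1), c k * (q ^ k)⁻¹ * qPoch U q k) -
      ∑ k ∈ Finset.range n,
        c (k + 1) * (1 - q ^ (k + 1)) * (q ^ (k + 1))⁻¹ * (1 - A * q ^ k) * qPoch U q k := by
  induction n with
  | zero => simp; ring
  | succ n ih =>
    rw [Finset.sum_range_succ (fun k => c k * qPoch (U / q) q k) (n + 1),
      Finset.sum_range_succ (fun k => c k * qPoch U q k) (n + 1),
      Finset.sum_range_succ (fun k => c k * (q ^ k)⁻¹ * qPoch U q k) (n + 1),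
      Finset.sum_range_succ (fun k => c (k + 1) * (1 - q ^ (k + 1)) * (q ^ (k + 1))⁻¹ *
        (1 - A * q ^ k) * qPoch U q k) n]
    have h1 : qPoch (U / q) q (n + 1) = (1 - U / q) * qPoch U q n := by
      rw [qPoch_succ', div_mul_cancel₀ _ hq]
    have h2 := qPoch_succ U q n
    have hV : V = U⁻¹ := eq_inv_of_mul_eq_one_left hUV
    have hU : U ≠ 0 := right_ne_zero_of_mul_eq_one hUV
    -- Both `(U/q;q)_{n+1}` and `(U;q)_{n+1}` are multiples of `(U;q)_n`, so the new term is an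
    -- identity between linear factors.
    have key : (1 - A * V) * qPoch (U / q) q (n + 1) + A * V * qPoch U q (n + 1) =
        (q ^ (n + 1))⁻¹ * qPoch U q (n + 1) -
        (1 - q ^ (n + 1)) * (q ^ (n + 1))⁻¹ * (1 - A * q ^ n) * qPoch U q n := by
      rw [h1, h2, hV]
      field_simp
      ring
    linear_combination ih + c (n + 1) * key

/-- The counterpart of `hahnPoly_raise` for `A_-`, from `N` to `N - 1`. Unlike that relation it
mixes the neighbouring terms `k` and `k + 1`, so coefficients of `(U;q)_k` are compared after
summation by parts, using the ratio of consecutive coefficients. -/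
theorem hahnPoly_lower {q A B U ν V : ℝ} (hq0 : 0 < q) (hq1 : q < 1) (hν : ν ≠ 0)
    (hUV : V * U = 1) (n : ℕ) (hn : ∀ k < n, 1 - ν * q ^ k ≠ 0) :
    (1 - A * V) * hahnPoly q A B (U / q) ν n +
        (A * V - A * B / q / ν) * hahnPoly q A B U ν n =
      ((q ^ n)⁻¹ - A * B / q / ν) * hahnPoly q A B U (ν * q) n := by
  have hq : q ≠ 0 := hq0.ne'
  have hs := sum_qPoch_shift (A := A) hq hUV (hahnCoeff q A B ν n) n
  have hcoef : ∀ k < n, hahnCoeff q A B ν n k * (q ^ k)⁻¹ -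
      hahnCoeff q A B ν n (k + 1) * (1 - q ^ (k + 1)) * (q ^ (k + 1))⁻¹ * (1 - A * q ^ k) -
      A * B / q / ν * hahnCoeff q A B ν n k =
      ((q ^ n)⁻¹ - A * B / q / ν) * hahnCoeff q A B (ν * q) n k := by
    intro k hk
    have h1 := hahnCoeff_succ (A := A) (B := B) (ν := ν) hq0 hq1 hk
    have h2 : hahnCoeff q A B (ν * q) n k * (1 - ν * q ^ k) =
        hahnCoeff q A B ν n k * (1 - ν * q ^ n) := by
      have := one_sub_mul_qPoch (ν * q ^ k) q (n - k)
      rw [mul_assoc ν, mul_assoc, ← pow_add, Nat.add_sub_cancel' hk.le] at this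
      unfold hahnCoeff
      rw [show ν * q * q ^ k = ν * (q ^ k * q) by ring]
      linear_combination (qPoch (A * q ^ k) q (n - k) * qPoch (q ^ n)⁻¹ q k *
        qPoch (q ^ n * (A * B / q)) q k / qPoch q q k * q ^ k) * this
    refine mul_right_cancel₀ (hn k hk) ?_
    have e : hahnCoeff q A B ν n (k + 1) * (1 - q ^ (k + 1)) * (q ^ (k + 1))⁻¹ * (1 - A * q ^ k) *
        (1 - ν * q ^ k) = hahnCoeff q A B ν n k * (1 - (q ^ n)⁻¹ * q ^ k) *
          (1 - q ^ n * (A * B / q) * q ^ k) * q * (q ^ (k + 1))⁻¹ := by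
      rw [← h1]; ring
    rw [sub_mul, sub_mul, e, mul_assoc _ (hahnCoeff q A B (ν * q) n k), h2]
    field_simp
    ring
  -- For `k = n` the product containing `ν` is empty, so the top coefficient does not see the shift
  -- of `ν`.
  have hlast : hahnCoeff q A B ν n n = hahnCoeff q A B (ν * q) n n := by
    simp [hahnCoeff]
  unfold hahnPoly
  rw [show ∀ X Y : ℝ, (1 - A * V) * X + (A * V - A * B / q / ν) * Y =
    (1 - A * V) * X + A * V * Y - A * B / q / ν * Y by intros; ring, hs]
  rw [Finset.sum_range_succ _ n, Finset.sum_range_succ _ n, Finset.sum_range_succ _ n, ← hlast]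
  have : ∑ k ∈ Finset.range n, hahnCoeff q A B ν n k * (q ^ k)⁻¹ * qPoch U q k -
      ∑ k ∈ Finset.range n, hahnCoeff q A B ν n (k + 1) * (1 - q ^ (k + 1)) * (q ^ (k + 1))⁻¹ *
        (1 - A * q ^ k) * qPoch U q k -
      A * B / q / ν * ∑ k ∈ Finset.range n, hahnCoeff q A B ν n k * qPoch U q k =
      ((q ^ n)⁻¹ - A * B / q / ν) *
        ∑ k ∈ Finset.range n, hahnCoeff q A B (ν * q) n k * qPoch U q k := by
    rw [Finset.mul_sum, Finset.mul_sum, ← Finset.sum_sub_distrib, ← Finset.sum_sub_distrib]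
    refine Finset.sum_congr rfl fun k hk => ?_
    linear_combination qPoch U q k * hcoef k (Finset.mem_range.1 hk)
  linear_combination this

/-- There is no vector of degree `n` at total level `n - 1`: the terms `k < n` contain the factor `1
- q^{-(n-1)} q^{n-1}`, and the term `k = n` contains `(q^{-x};q)_n = 0`. Hence `A_-` kills the
lowest weight vector. -/
theorem hahnPoly_eq_zero {q A B : ℝ} (hq0 : 0 < q) {n x : ℕ} (hx : x < n) :
    hahnPoly q A B (q ^ x)⁻¹ ((q ^ n)⁻¹ * q) n = 0 := by
  have hq : q ≠ 0 := hq0.ne'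
  refine Finset.sum_eq_zero fun k hk => ?_
  have hk : k ≤ n := Nat.lt_succ_iff.1 (Finset.mem_range.1 hk)
  rcases hk.lt_or_eq with h | rfl
  · have : qPoch ((q ^ n)⁻¹ * q * q ^ k) q (n - k) = 0 := by
      refine Finset.prod_eq_zero (i := n - k - 1) (Finset.mem_range.2 (by omega)) ?_
      have e : n = k + (n - k - 1) + 1 := by omega
      rw [mul_assoc, mul_assoc, ← pow_add, ← pow_succ', ← e, inv_mul_cancel₀ (pow_pos hq0 n).ne',
        sub_self]
    simp [hahnCoeff, this]
  · rw [qPoch_inv_pow_eq_zero hq0 hx, mul_zero]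

/-! ### The `q`-Vandermonde sum -/

theorem qVandermonde {q : ℝ} (hq0 : 0 < q) (hq1 : q < 1) (n : ℕ) (A B : ℝ) :
    ∑ p ∈ antidiagonal n, q ^ (p.1 * (p.1 - 1)) * A ^ p.1 * qPoch (A * q ^ p.1) q p.2 *
        qPoch (B * q ^ p.2) q p.1 / (qPoch q q p.1 * qPoch q q p.2) =
      qPoch (A * B * q ^ (n - 1)) q n / qPoch q q n := by
  have hP : ∀ k, qPoch q q k ≠ 0 := fun k => (qPoch_pos hq0 hq1 hq1 k).ne'
  have hs : ∀ k, 1 - q * q ^ k ≠ 0 := fun k => by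
    have : q ^ (k + 1) < 1 := pow_lt_one₀ hq0.le hq1 (by omega)
    rw [pow_succ'] at this
    linarith
  induction n generalizing A B with
  | zero => simp
  | succ n ih =>
    set t : ℝ → ℝ → ℕ × ℕ → ℝ := fun A B p => q ^ (p.1 * (p.1 - 1)) * A ^ p.1 *
      qPoch (A * q ^ p.1) q p.2 * qPoch (B * q ^ p.2) q p.1 / (qPoch q q p.1 * qPoch q q p.2)
      with ht
    -- Splitting `1 - q^{x+z}` as `(1 - q^z) + q^z (1 - q^x)` cancels a factor of `(q;q)_z` or of
    -- `(q;q)_x`. This leaves the sums for `n` with parameters `(A, Bq)` and `(Aq, B)`, which have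
    -- the same value.
    have hsplit : ∀ p ∈ antidiagonal (n + 1), (1 - q ^ (n + 1)) * t A B p =
        (1 - q ^ p.2) * t A B p + q ^ p.2 * (1 - q ^ p.1) * t A B p := by
      intro p hp
      rw [← mem_antidiagonal.1 hp, pow_add]
      ring
    have h1 : ∑ p ∈ antidiagonal (n + 1), (1 - q ^ p.2) * t A B p =
        (1 - A * q ^ n) * ∑ p ∈ antidiagonal n, t A (B * q) p := by
      rw [Finset.Nat.sum_antidiagonal_succ', Finset.mul_sum]
      simp only [pow_zero, sub_self, zero_mul, zero_add]
      refine Finset.sum_congr rfl fun p hp => ?_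
      have e : A * q ^ n = A * q ^ p.1 * q ^ p.2 := by
        rw [mul_assoc, ← pow_add, mem_antidiagonal.1 hp]
      simp only [ht]
      rw [e, qPoch_succ (A * q ^ p.1), qPoch_succ q q p.2,
        show B * q ^ (p.2 + 1) = B * q * q ^ p.2 by ring, pow_succ' q p.2]
      have := hP p.1
      have := hP p.2
      have := hs p.2
      field_simp
    have h2 : ∑ p ∈ antidiagonal (n + 1), q ^ p.2 * (1 - q ^ p.1) * t A B p =
        A * q ^ n * (1 - B * q ^ n) * ∑ p ∈ antidiagonal n, t (A * q) B p := by
      rw [Finset.Nat.sum_antidiagonal_succ, Finset.mul_sum]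
      simp only [pow_zero, sub_self, mul_zero, zero_mul, zero_add]
      refine Finset.sum_congr rfl fun p hp => ?_
      have e : q ^ n = q ^ p.2 * q ^ p.1 := by
        rw [← pow_add, add_comm, mem_antidiagonal.1 hp]
      have e2 : q ^ ((p.1 + 1) * (p.1 + 1 - 1)) = q ^ (p.1 * (p.1 - 1)) * q ^ p.1 * q ^ p.1 := by
        rw [← pow_add, ← pow_add]
        congr 1
        rcases p.1 with _ | k
        · rfl
        · simp only [Nat.add_sub_cancel]; ring
      simp only [ht]
      rw [e2, e, qPoch_succ (B * q ^ p.2), qPoch_succ q q p.1,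
        show A * q ^ (p.1 + 1) = A * q * q ^ p.1 by ring, pow_succ' q p.1, mul_pow A q]
      have := hP p.1
      have := hP p.2
      have := hs p.1
      field_simp
      ring
    have hn : (1 - q ^ (n + 1)) ≠ 0 := by rw [pow_succ']; exact hs n
    refine mul_left_cancel₀ hn ?_
    rw [Finset.mul_sum, Finset.sum_congr rfl hsplit, Finset.sum_add_distrib, h1, h2, ih, ih]
    have e3 : A * (B * q) * q ^ (n - 1) = A * q * B * q ^ (n - 1) := by ring
    have hc := hP n
    have hd := hs n
    have hcancel : ∀ X : ℝ, (1 - q ^ (n + 1)) * (X / qPoch q q (n + 1)) = X / qPoch q q n := by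
      intro X
      rw [qPoch_succ q q n, pow_succ' q n]
      generalize 1 - q * q ^ n = D at hd
      field_simp
    rw [e3, hcancel]
    -- The exponent `n - 1` is truncated at `n = 0`, where the power of `q` cannot be merged.
    rcases n with _ | n
    · simp [qPoch]
      ring
    · have e4 : A * q * B * q ^ (n + 1 - 1) = A * B * q ^ (n + 1) := by
        rw [Nat.add_sub_cancel]; ring
      rw [e4, show n + 1 + 1 - 1 = n + 1 by omega, qPoch_succ (A * B * q ^ (n + 1)) q (n + 1)]
      ring

/-! ### Weights, norms and matrix elements -/

section
variable {q a b : ℝ} (hq0 : 0 < q) (hq1 : q < 1) (ha : 0 < a) (hb : 0 < b)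

theorem one_sub_pow_pos {q : ℝ} (hq0 : 0 < q) (hq1 : q < 1) (n : ℕ) : 0 < 1 - q ^ (n + 1) := by
  have : q ^ (n + 1) < 1 := pow_lt_one₀ hq0.le hq1 (by omega)
  linarith

theorem one_sub_mul_pow_pos {q A : ℝ} (hq0 : 0 < q) (hq1 : q < 1) (hA : A < 1)
    (n : ℕ) : 0 < 1 - A * q ^ n := by
  have h1 : q ^ n ≤ 1 := pow_le_one₀ hq0.le hq1.le
  have h2 : 0 < q ^ n := pow_pos hq0 n
  rcases le_or_gt A 0 with h | h <;> nlinarith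

theorem rpow_mul_rpow_lt_one {q : ℝ} (hq0 : 0 < q) (hq1 : q < 1) {a b : ℝ} (ha : 0 < a)
    (hb : 0 < b) : q ^ (a + 1) * q ^ (b + 1) < 1 := by
  rw [← Real.rpow_add hq0]
  exact Real.rpow_lt_one hq0.le hq1 (by linarith)

theorem rpow_mul_rpow_div_lt_one {q : ℝ} (hq0 : 0 < q) (hq1 : q < 1) {a b : ℝ} (ha : 0 < a)
    (hb : 0 < b) : q ^ (a + 1) * q ^ (b + 1) / q < 1 := by
  rw [← Real.rpow_add hq0, ← Real.rpow_sub_one hq0.ne']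
  exact Real.rpow_lt_one hq0.le hq1 (by linarith)

include hq0 in
theorem omega_add (x z : ℕ) :
    omega q x a b (x + z) = qPoch (q ^ (a + 1)) q x * qPoch (q ^ (b + 1)) q z /
      (qPoch q q x * qPoch q q z) * (q ^ (a + 1)) ^ z := by
  unfold omega
  rw [Nat.add_sub_cancel_left, ← Real.rpow_mul_natCast hq0.le]
  congr 2
  push_cast
  ring

include hq0 hq1 ha hb in
theorem omega_pos (x z : ℕ) : 0 < omega q x a b (x + z) := by
  rw [omega_add hq0]
  have hA := rpow_add_one_lt_one hq0 hq1 ha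
  have hB := rpow_add_one_lt_one hq0 hq1 hb
  have := qPoch_pos hq0 hq1 hq1 x
  have := qPoch_pos hq0 hq1 hq1 z
  have := qPoch_pos hq0 hq1 hA x
  have := qPoch_pos hq0 hq1 hB z
  positivity

include hq0 hq1 in
theorem omega_succ_left (x z : ℕ) :
    omega q (x + 1) a b (x + 1 + z) =
      omega q x a b (x + z) * (1 - q ^ (a + 1) * q ^ x) / (1 - q ^ (x + 1)) := by
  rw [omega_add hq0, omega_add hq0, qPoch_succ, qPoch_succ, ← pow_succ']
  have := (qPoch_pos hq0 hq1 hq1 x).ne'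
  have := (qPoch_pos hq0 hq1 hq1 z).ne'
  have h := (one_sub_pow_pos hq0 hq1 x).ne'
  generalize 1 - q ^ (x + 1) = D at h ⊢
  field_simp

include hq0 hq1 in
theorem omega_succ_right (x z : ℕ) :
    omega q x a b (x + (z + 1)) =
      omega q x a b (x + z) * (1 - q ^ (b + 1) * q ^ z) * q ^ (a + 1) / (1 - q ^ (z + 1)) := by
  rw [omega_add hq0, omega_add hq0, qPoch_succ, qPoch_succ, ← pow_succ']
  have := (qPoch_pos hq0 hq1 hq1 x).ne'
  have := (qPoch_pos hq0 hq1 hq1 z).ne'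
  have h := (one_sub_pow_pos hq0 hq1 z).ne'
  generalize 1 - q ^ (z + 1) = D at h ⊢
  field_simp
  ring

include hq0 in
-- In terms of `r = N - n` the exponent `2 * n.choose 2 - 2 N n` is minus a natural number, so that
-- raising `N` with `n` fixed only changes `r`.
theorem eta_add (n r : ℕ) :
    eta q n a b (n + r) = qPoch (q ^ (a + 1) * q ^ (b + 1)) q (2 * n + r) / qPoch q q r *
      (q ^ (n * (n + 1) + 2 * n * r))⁻¹ *
      ((1 - q ^ (a + 1) * q ^ (b + 1) / q) / (1 - q ^ (a + 1) * q ^ (b + 1) / q * q ^ (2 * n))) *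
      (qPoch q q n * qPoch (q ^ (a + 1)) q n * qPoch (q ^ (b + 1)) q n /
        qPoch (q ^ (a + 1) * q ^ (b + 1) / q) q n) * (q ^ (a + 1)) ^ n := by
  have h1 : q ^ (a + b + 2) = q ^ (a + 1) * q ^ (b + 1) := by
    rw [← Real.rpow_add hq0]; congr 1; ring
  have h2 : q ^ (a + b + 1) = q ^ (a + 1) * q ^ (b + 1) / q := by
    rw [← Real.rpow_add hq0, ← Real.rpow_sub_one hq0.ne']; congr 1; ring
  have h3 : q ^ (2 * (n : ℝ) + a + b + 1) = q ^ (a + 1) * q ^ (b + 1) / q * q ^ (2 * n) := by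
    rw [← h2, ← Real.rpow_natCast, ← Real.rpow_add hq0]; congr 1; push_cast; ring
  have h4 : q ^ (2 * (n.choose 2 : ℝ) - 2 * ((n + r : ℕ) : ℝ) * n) =
      (q ^ (n * (n + 1) + 2 * n * r))⁻¹ := by
    rw [← rpow_neg_nat hq0, Nat.cast_choose_two]; congr 1; push_cast; ring
  have h5 : q ^ ((n : ℝ) * (a + 1)) = (q ^ (a + 1)) ^ n := by
    rw [← Real.rpow_mul_natCast hq0.le]; congr 1; ring
  unfold eta
  rw [h1, h2, h3, h4, h5, Nat.add_sub_cancel_left, show n + (n + r) = 2 * n + r by ring]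

include hq0 hq1 ha hb in
theorem eta_pos (n r : ℕ) : 0 < eta q n a b (n + r) := by
  rw [eta_add hq0]
  have hA := rpow_add_one_lt_one hq0 hq1 ha
  have hB := rpow_add_one_lt_one hq0 hq1 hb
  have hC := rpow_mul_rpow_lt_one hq0 hq1 ha hb
  have hD := rpow_mul_rpow_div_lt_one hq0 hq1 ha hb
  have := qPoch_pos hq0 hq1 hq1 n
  have := qPoch_pos hq0 hq1 hq1 r
  have := qPoch_pos hq0 hq1 hA n
  have := qPoch_pos hq0 hq1 hB n
  have := qPoch_pos hq0 hq1 hC (2 * n + r)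
  have := qPoch_pos hq0 hq1 hD n
  have := one_sub_mul_pow_pos hq0 hq1 hD (2 * n)
  have := sub_pos.2 hD
  positivity

include hq0 hq1 in
theorem eta_succ (n r : ℕ) :
    eta q n a b (n + (r + 1)) =
      eta q n a b (n + r) * (1 - q ^ (a + 1) * q ^ (b + 1) * q ^ (2 * n + r)) /
        ((1 - q ^ (r + 1)) * (q ^ n) ^ 2) := by
  rw [eta_add hq0, eta_add hq0, ← add_assoc, qPoch_succ, qPoch_succ, ← pow_succ']
  have h1 : q ^ (n * (n + 1) + 2 * n * (r + 1)) =
      q ^ (n * (n + 1) + 2 * n * r) * (q ^ n) ^ 2 := by ring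
  rw [h1]
  have := (qPoch_pos hq0 hq1 hq1 r).ne'
  have h := (one_sub_pow_pos hq0 hq1 r).ne'
  generalize 1 - q ^ (r + 1) = D at h ⊢
  rw [mul_inv]
  generalize (q ^ (n * (n + 1) + 2 * n * r))⁻¹ = E
  generalize (q ^ n) ^ 2 = F
  generalize (1 - q ^ (a + 1) * q ^ (b + 1) / q) /
    (1 - q ^ (a + 1) * q ^ (b + 1) / q * q ^ (2 * n)) = G
  rw [div_eq_mul_inv, div_eq_mul_inv, mul_inv, div_eq_mul_inv _ (D * F), mul_inv]
  ring

/-- The normalization of the matrix elements `σ_n`. -/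
def sigmaScale (q : ℝ) : ℝ := q ^ (1 / 2 : ℝ) / (1 - q) ^ 2

include hq0 hq1 in
theorem sigmaScale_pos : 0 < sigmaScale q := by
  have : 0 < 1 - q := by linarith
  unfold sigmaScale
  positivity

@[simp]
theorem sigma_zero : sigma q a 0 = 0 := by simp [sigma]

include hq0 in
theorem sigma_succ (n : ℕ) :
    sigma q a (n + 1) = sigmaScale q * (1 - q ^ (n + 1)) * (1 - q ^ (a + 1) * q ^ n) := by
  have : q ^ (((n + 1 : ℕ) : ℝ) + a) = q ^ (a + 1) * q ^ n := by
    rw [← Real.rpow_natCast, ← Real.rpow_add hq0]; congr 1; push_cast; ring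
  unfold sigma sigmaScale
  rw [this]
  ring

include hq0 in
theorem sigma_coupled_succ (n r : ℕ) :
    sigma q (a + b + 1 + 2 * n) (r + 1) = sigmaScale q * (1 - q ^ (r + 1)) *
      (1 - q ^ (a + 1) * q ^ (b + 1) * q ^ (2 * n + r)) := by
  have : q ^ (a + b + 1 + 2 * n + 1) = q ^ (a + 1) * q ^ (b + 1) * q ^ (2 * n) := by
    rw [← Real.rpow_natCast, ← Real.rpow_add hq0, ← Real.rpow_add hq0]
    congr 1; push_cast; ring
  rw [sigma_succ hq0, this, pow_add]
  ring

include hq0 hq1 ha in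
theorem sigma_succ_pos (n : ℕ) : 0 < sigma q a (n + 1) := by
  rw [sigma_succ hq0]
  have := sigmaScale_pos hq0 hq1
  have := one_sub_pow_pos hq0 hq1 n
  have := one_sub_mul_pow_pos hq0 hq1 (rpow_add_one_lt_one hq0 hq1 ha) n
  positivity

include hq0 hq1 ha in
theorem sigma_nonneg (n : ℕ) : 0 ≤ sigma q a n := by
  rcases n with _ | n
  · simp
  · exact (sigma_succ_pos hq0 hq1 ha n).le

/-! ### The ladder relations of the `q`-Hahn functions -/

theorem sqrt_mul_eq_sqrt_mul {X Y u v : ℝ} (hu : 0 ≤ u) (hv : 0 ≤ v)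
    (h : X * u ^ 2 = Y * v ^ 2) : √X * u = √Y * v := by
  rw [← Real.sqrt_sq hu, ← Real.sqrt_sq hv, ← Real.sqrt_mul' _ (sq_nonneg _),
    ← Real.sqrt_mul' _ (sq_nonneg _), h]

include hq0 hq1 ha in
theorem qHahnHat_eq {n x N : ℕ} (hx : x ≤ N) (hn : n ≤ N) :
    qHahnHat q n x a b N = √(omega q x a b N / eta q n a b N) *
      hahnPoly q (q ^ (a + 1)) (q ^ (b + 1)) (q ^ x)⁻¹ (q ^ N)⁻¹ n := by
  rw [qHahnHat, if_pos ⟨by positivity, by exact_mod_cast hx, by exact_mod_cast hn⟩]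
  simp only [Int.toNat_natCast]
  rw [qHahn_eq_hahnPoly hq0 hq1 ha hn]

theorem qHahnHat_eq_zero_of_gt {n : ℕ} {x N : ℤ} (h : N < x) : qHahnHat q n x a b N = 0 :=
  if_neg fun H => by omega

theorem qHahnHat_eq_zero_of_neg {n : ℕ} {x N : ℤ} (h : x < 0) : qHahnHat q n x a b N = 0 :=
  if_neg fun H => by omega

include hq0 in
theorem rpow_level_sq (x : ℕ) : (q ^ ((x : ℝ) + (a + 1) / 2)) ^ 2 = (q ^ x) ^ 2 * q ^ (a + 1) := by
  rw [← Real.rpow_natCast, ← Real.rpow_natCast, ← Real.rpow_natCast, ← Real.rpow_mul hq0.le,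
    ← Real.rpow_mul hq0.le, ← Real.rpow_add hq0]
  congr 1
  push_cast
  ring

include hq0 hq1 ha hb in
-- Coefficient of `e_x ⊗ e_z` in the image of the coupled vector under `A_+ ⊗ 1 + q^{A_0} ⊗ A_+`.
-- After multiplication by `q^n - q^{N+1}`, with `N = n + r`, the square roots in all three terms
-- reduce to a common factor `S` times the coefficients of `hahnPoly_raise`.
theorem qHahnHat_raise {n r x z : ℕ} (h : x + z = n + r + 1) :
    √(sigma q a x) * qHahnHat q n ((x : ℤ) - 1) a b ((n + r : ℕ) : ℤ) +
        q ^ ((x : ℝ) + (a + 1) / 2) * √(sigma q b z) * qHahnHat q n x a b ((n + r : ℕ) : ℤ) =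
      √(sigma q (a + b + 1 + 2 * n) (r + 1)) * qHahnHat q n x a b ((n + r + 1 : ℕ) : ℤ) := by
  set A := q ^ (a + 1) with hA
  set B := q ^ (b + 1) with hB
  have hA1 : A < 1 := rpow_add_one_lt_one hq0 hq1 ha
  have hB1 : B < 1 := rpow_add_one_lt_one hq0 hq1 hb
  have hA0 : 0 < A := Real.rpow_pos_of_pos hq0 _
  set c := a + b + 1 + 2 * (n : ℝ) with hc
  have hc0 : 0 < c := by positivity
  set S := √(sigma q c (r + 1) * (omega q x a b (n + r + 1) / eta q n a b (n + r + 1))) with hS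
  have hη := eta_pos hq0 hq1 ha hb n r
  have hη' := eta_succ (a := a) (b := b) hq0 hq1 n r
  have hQ : 0 < q ^ n := pow_pos hq0 n
  have hR1 := one_sub_pow_pos hq0 hq1 r
  have hR2 := one_sub_mul_pow_pos hq0 hq1 (rpow_mul_rpow_lt_one hq0 hq1 ha hb) (2 * n + r)
  have hfac : q ^ n - q ^ (n + r + 1) = q ^ n * (1 - q ^ (r + 1)) := by ring
  have hσc := sigma_coupled_succ (a := a) (b := b) hq0 n r
  have hT1 : √(sigma q a x) * qHahnHat q n ((x : ℤ) - 1) a b ((n + r : ℕ) : ℤ) *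
      (q ^ n - q ^ (n + r + 1)) =
      S * (1 - q ^ x) * hahnPoly q A B ((q ^ x)⁻¹ * q) (q ^ (n + r))⁻¹ n := by
    rcases x with _ | x
    · simp
    · have h' : x + z = n + r := by omega
      rw [show (((x + 1 : ℕ) : ℤ) - 1) = (x : ℤ) by push_cast; ring,
        qHahnHat_eq hq0 hq1 ha (by omega) (by omega),
        show (q ^ (x + 1))⁻¹ * q = (q ^ x)⁻¹ by rw [pow_succ]; field_simp]
      have key : √(sigma q a (x + 1)) * √(omega q x a b (n + r) / eta q n a b (n + r)) *
          (q ^ n - q ^ (n + r + 1)) = S * (1 - q ^ (x + 1)) := by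
        rw [← Real.sqrt_mul (sigma_nonneg hq0 hq1 ha _)]
        refine sqrt_mul_eq_sqrt_mul ?_ (one_sub_pow_pos hq0 hq1 x).le ?_
        · rw [hfac]; positivity
        · have hω := omega_succ_left (a := a) (b := b) hq0 hq1 x z
          rw [show x + 1 + z = n + r + 1 by omega, h'] at hω
          have hX1 := (one_sub_pow_pos hq0 hq1 x).ne'
          rw [hσc, sigma_succ hq0, hω, add_assoc n r 1, hη', ← add_assoc, hfac, ← hA, ← hB]
          generalize 1 - q ^ (x + 1) = X1 at hX1 ⊢
          generalize 1 - A * q ^ x = X2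
          rw [← hA, ← hB] at hR2
          generalize 1 - A * B * q ^ (2 * n + r) = R2 at hR2 ⊢
          generalize 1 - q ^ (r + 1) = R1 at hR1 ⊢
          generalize q ^ n = Q at hQ ⊢
          field_simp
      rw [← key]
      ring
  have hT2 : q ^ ((x : ℝ) + (a + 1) / 2) * √(sigma q b z) *
      qHahnHat q n x a b ((n + r : ℕ) : ℤ) * (q ^ n - q ^ (n + r + 1)) =
      S * (q ^ x - q ^ (n + r + 1)) * hahnPoly q A B (q ^ x)⁻¹ (q ^ (n + r))⁻¹ n := by
    -- At `z = 0` both sides vanish: `σ_0 = 0` on the left, and `q^x = q^{n+r+1}` on the right.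
    rcases z with _ | z
    · have : x = n + r + 1 := by omega
      simp [this]
    · have h' : x + z = n + r := by omega
      rw [qHahnHat_eq hq0 hq1 ha (by omega) (by omega)]
      have hfac2 : q ^ x - q ^ (n + r + 1) = q ^ x * (1 - q ^ (z + 1)) := by
        rw [← h]; ring
      have hX0 : 0 < q ^ x := pow_pos hq0 x
      have hX1 := one_sub_pow_pos hq0 hq1 z
      have key : √(sigma q b (z + 1)) * √(omega q x a b (n + r) / eta q n a b (n + r)) *
          (q ^ ((x : ℝ) + (a + 1) / 2) * (q ^ n - q ^ (n + r + 1))) =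
          S * (q ^ x - q ^ (n + r + 1)) := by
        rw [← Real.sqrt_mul (sigma_nonneg hq0 hq1 hb _)]
        refine sqrt_mul_eq_sqrt_mul ?_ ?_ ?_
        · rw [hfac]; positivity
        · rw [hfac2]; positivity
        · have hω := omega_succ_right (a := a) (b := b) hq0 hq1 x z
          rw [show x + (z + 1) = n + r + 1 by omega, h'] at hω
          rw [mul_pow (q ^ ((x : ℝ) + (a + 1) / 2)), rpow_level_sq hq0]
          rw [hσc, sigma_succ hq0, hω, add_assoc n r 1, hη', ← add_assoc, hfac, hfac2, ← hA, ← hB]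
          generalize 1 - q ^ (z + 1) = X1 at hX1 ⊢
          generalize 1 - B * q ^ z = X2
          rw [← hA, ← hB] at hR2
          generalize 1 - A * B * q ^ (2 * n + r) = R2 at hR2 ⊢
          generalize 1 - q ^ (r + 1) = R1 at hR1 ⊢
          generalize q ^ n = Q at hQ ⊢
          generalize q ^ x = X0 at hX0 ⊢
          field_simp
      rw [← key]
      ring
  have hT3 : √(sigma q c (r + 1)) * qHahnHat q n x a b ((n + r + 1 : ℕ) : ℤ) =
      S * hahnPoly q A B (q ^ x)⁻¹ (q ^ (n + r + 1))⁻¹ n := by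
    rw [qHahnHat_eq hq0 hq1 ha (by omega) (by omega), ← mul_assoc,
      ← Real.sqrt_mul (sigma_nonneg hq0 hq1 hc0 _)]
  have hne : q ^ n - q ^ (n + r + 1) ≠ 0 := by rw [hfac]; positivity
  refine mul_right_cancel₀ hne ?_
  rw [add_mul, hT1, hT2, hT3]
  have hx0 : q ^ x ≠ 0 := (pow_pos hq0 x).ne'
  have := hahnPoly_raise (A := A) (B := B) (ν := (q ^ (n + r))⁻¹) hq0.ne'
    (inv_ne_zero (pow_pos hq0 _).ne') (mul_inv_cancel₀ hx0) n
  rw [div_inv_eq_mul, ← pow_succ', show (q ^ (n + r))⁻¹ / q = (q ^ (n + r + 1))⁻¹ by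
    rw [pow_succ, mul_inv, div_eq_mul_inv]] at this
  linear_combination S * this

include hq0 hq1 ha hb in
theorem qHahnHat_lower {n r x z : ℕ} (h : x + z + 1 = n + r) :
    √(sigma q a (x + 1)) * qHahnHat q n ((x + 1 : ℕ) : ℤ) a b ((x + z + 1 : ℕ) : ℤ) +
        q ^ ((x : ℝ) + (a + 1) / 2) * √(sigma q b (z + 1)) *
          qHahnHat q n x a b ((x + z + 1 : ℕ) : ℤ) =
      √(sigma q (a + b + 1 + 2 * n) r) * qHahnHat q n x a b ((x + z : ℕ) : ℤ) := by
  set A := q ^ (a + 1) with hA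
  set B := q ^ (b + 1) with hB
  have hA1 : A < 1 := rpow_add_one_lt_one hq0 hq1 ha
  have hB1 : B < 1 := rpow_add_one_lt_one hq0 hq1 hb
  have hA0 : 0 < A := Real.rpow_pos_of_pos hq0 _
  set c := a + b + 1 + 2 * (n : ℝ) with hc
  have hc0 : 0 < c := by positivity
  set S := √(sigmaScale q * (omega q x a b (x + z) / eta q n a b (x + z + 1))) with hS
  have hQ : 0 < q ^ n := pow_pos hq0 n
  have hX0 : 0 < q ^ x := pow_pos hq0 x
  have hη := eta_pos hq0 hq1 ha hb n r
  rw [← h] at hη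
  have hT1 : √(sigma q a (x + 1)) * √(omega q (x + 1) a b (x + z + 1) / eta q n a b (x + z + 1)) =
      S * (1 - A * q ^ x) := by
    rw [← Real.sqrt_mul (sigma_nonneg hq0 hq1 ha _), ← mul_one √(_ * _)]
    refine sqrt_mul_eq_sqrt_mul zero_le_one (one_sub_mul_pow_pos hq0 hq1 hA1 x).le ?_
    have hω := omega_succ_left (a := a) (b := b) hq0 hq1 x z
    rw [show x + 1 + z = x + z + 1 by omega] at hω
    have hX1 := (one_sub_pow_pos hq0 hq1 x).ne'
    rw [sigma_succ hq0, hω, ← hA]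
    generalize 1 - q ^ (x + 1) = X1 at hX1 ⊢
    generalize 1 - A * q ^ x = X2
    field_simp
  have hT2 : √(sigma q b (z + 1)) * √(omega q x a b (x + z + 1) / eta q n a b (x + z + 1)) *
      q ^ ((x : ℝ) + (a + 1) / 2) = S * (A * q ^ x * (1 - B * q ^ z)) := by
    rw [← Real.sqrt_mul (sigma_nonneg hq0 hq1 hb _)]
    have hX2 := one_sub_mul_pow_pos hq0 hq1 hB1 z
    refine sqrt_mul_eq_sqrt_mul (Real.rpow_nonneg hq0.le _) (by positivity) ?_
    have hω := omega_succ_right (a := a) (b := b) hq0 hq1 x z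
    rw [← add_assoc] at hω
    have hX1 := (one_sub_pow_pos hq0 hq1 z).ne'
    rw [rpow_level_sq hq0, sigma_succ hq0, hω, ← hA, ← hB]
    generalize 1 - q ^ (z + 1) = X1 at hX1 ⊢
    generalize 1 - B * q ^ z = X2
    field_simp
  rw [qHahnHat_eq hq0 hq1 ha (by omega) (by omega), qHahnHat_eq hq0 hq1 ha (by omega) (by omega)]
  have hlow := hahnPoly_lower (A := A) (B := B) (ν := (q ^ (x + z + 1))⁻¹) hq0 hq1
    (inv_ne_zero (pow_pos hq0 _).ne') (mul_inv_cancel₀ hX0.ne') n (by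
      intro k hk
      have h1 : q ^ (x + z + 1) < q ^ k := pow_lt_pow_right_of_lt_one₀ hq0 hq1 (by omega)
      have h2 : 0 < q ^ (x + z + 1) := pow_pos hq0 _
      have : 1 < (q ^ (x + z + 1))⁻¹ * q ^ k := by
        rw [inv_mul_eq_div, one_lt_div h2]; exact h1
      linarith)
  rw [div_inv_eq_mul, show A * B / q * q ^ (x + z + 1) = A * B * q ^ (x + z) by
      rw [pow_succ]; field_simp,
    show (q ^ x)⁻¹ / q = (q ^ (x + 1))⁻¹ by rw [pow_succ, mul_inv, div_eq_mul_inv]] at hlow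
  have hlhs : √(sigma q a (x + 1)) * (√(omega q (x + 1) a b (x + z + 1) /
      eta q n a b (x + z + 1)) * hahnPoly q A B (q ^ (x + 1))⁻¹ (q ^ (x + z + 1))⁻¹ n) +
      q ^ ((x : ℝ) + (a + 1) / 2) * √(sigma q b (z + 1)) * (√(omega q x a b (x + z + 1) /
      eta q n a b (x + z + 1)) * hahnPoly q A B (q ^ x)⁻¹ (q ^ (x + z + 1))⁻¹ n) =
      S * (((q ^ n)⁻¹ - A * B * q ^ (x + z)) *
        hahnPoly q A B (q ^ x)⁻¹ ((q ^ (x + z + 1))⁻¹ * q) n) := by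
    rw [← hlow]
    linear_combination S * A * B * hahnPoly q A B (q ^ x)⁻¹ (q ^ (x + z + 1))⁻¹ n * pow_add q x z +
      hahnPoly q A B (q ^ (x + 1))⁻¹ (q ^ (x + z + 1))⁻¹ n * hT1 +
      hahnPoly q A B (q ^ x)⁻¹ (q ^ (x + z + 1))⁻¹ n * hT2
  rw [hlhs]
  -- At `r = 0` the vector has lowest weight: the right side carries `σ_0 = 0`, and the shifted
  -- polynomial on the left is zero.
  rcases r with _ | r
  · have hn : x + z + 1 = n := h
    rw [hn, hahnPoly_eq_zero hq0 (by omega), sigma_zero]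
    simp
  · have h' : x + z = n + r := by omega
    have hR2 := one_sub_mul_pow_pos hq0 hq1 (rpow_mul_rpow_lt_one hq0 hq1 ha hb) (2 * n + r)
    have hη0 := eta_pos hq0 hq1 ha hb n r
    rw [qHahnHat_eq hq0 hq1 ha (by omega) (by omega),
      show (q ^ (x + z + 1))⁻¹ * q = (q ^ (x + z))⁻¹ by rw [pow_succ, mul_inv]; field_simp]
    have key : √(sigma q c (r + 1)) * √(omega q x a b (x + z) / eta q n a b (x + z)) =
        S * ((q ^ n)⁻¹ - A * B * q ^ (x + z)) := by
      have hfac : (q ^ n)⁻¹ - A * B * q ^ (x + z) =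
          (q ^ n)⁻¹ * (1 - A * B * q ^ (2 * n + r)) := by
        rw [h', pow_add, pow_add, two_mul, pow_add]
        field_simp
      rw [← Real.sqrt_mul (sigma_nonneg hq0 hq1 hc0 _), ← mul_one √(_ * _), hfac]
      refine sqrt_mul_eq_sqrt_mul zero_le_one (by positivity) ?_
      rw [h, eta_succ hq0 hq1, sigma_coupled_succ hq0, h', ← hA, ← hB]
      rw [← hA, ← hB] at hR2
      have hR1 := one_sub_pow_pos hq0 hq1 r
      generalize 1 - A * B * q ^ (2 * n + r) = R2 at hR2 ⊢
      generalize 1 - q ^ (r + 1) = R1 at hR1 ⊢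
      generalize q ^ n = Q at hQ ⊢
      field_simp
    rw [← mul_assoc, ← mul_assoc, key]

end

/-! ### Orthonormality of the `q`-Hahn functions -/

section
variable {q a b : ℝ} (hq0 : 0 < q) (hq1 : q < 1) (ha : 0 < a) (hb : 0 < b)

theorem hahnPoly_one (q A B ν : ℝ) (n : ℕ) :
    hahnPoly q A B 1 ν n = qPoch A q n * qPoch ν q n := by
  unfold hahnPoly
  rw [Finset.sum_range_succ']
  rw [Finset.sum_eq_zero fun k _ => by rw [qPoch_succ']; simp]
  simp [hahnCoeff]

/-- The square of the `q`-Hahn polynomial of top degree `n = N`. -/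
theorem hahnPoly_top_sq {q A B : ℝ} (hq0 : 0 < q) (hq1 : q < 1) {n : ℕ} (x z : ℕ)
    (h : x + z = n) :
    hahnPoly q A B (q ^ x)⁻¹ (q ^ n)⁻¹ n ^ 2 * (qPoch A q x * qPoch B q z) ^ 2 =
      A ^ (2 * x) * q ^ (x * (x - 1)) * (qPoch A q n * qPoch (q ^ n)⁻¹ q n * qPoch B q n) ^ 2 := by
  induction x generalizing z with
  | zero =>
    obtain rfl : z = n := by omega
    simp [hahnPoly_one]
    ring
  | succ x ih =>
    have ih := ih (z + 1) (by omega)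
    have hX0 : q ^ x ≠ 0 := (pow_pos hq0 x).ne'
    have hlow := hahnPoly_lower (A := A) (B := B) (ν := (q ^ n)⁻¹) hq0 hq1
      (inv_ne_zero (pow_pos hq0 _).ne') (mul_inv_cancel₀ hX0) n (by
        intro k hk
        have h1 : q ^ n < q ^ k := pow_lt_pow_right_of_lt_one₀ hq0 hq1 (by omega)
        have h2 : 0 < q ^ n := pow_pos hq0 _
        have : 1 < (q ^ n)⁻¹ * q ^ k := by
          rw [inv_mul_eq_div, one_lt_div h2]; exact h1
        linarith)
    -- At `N = n` the lowering relation has zero right side and becomes a first-order recurrence in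
    -- `x`, which determines the polynomial from its value at `x = 0`.
    rw [hahnPoly_eq_zero hq0 (by omega), mul_zero, div_inv_eq_mul,
      show A * B / q * q ^ n = A * B * q ^ (x + z) by
        rw [← h, show x + 1 + z = x + z + 1 by ring, pow_succ]; field_simp,
      show (q ^ x)⁻¹ / q = (q ^ (x + 1))⁻¹ by rw [pow_succ, mul_inv, div_eq_mul_inv]] at hlow
    have hlow2 : (1 - A * q ^ x) * hahnPoly q A B (q ^ (x + 1))⁻¹ (q ^ n)⁻¹ n =
        -(A * q ^ x * (1 - B * q ^ z) * hahnPoly q A B (q ^ x)⁻¹ (q ^ n)⁻¹ n) := by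
      linear_combination hlow +
        A * B * hahnPoly q A B (q ^ x)⁻¹ (q ^ n)⁻¹ n * pow_add q x z
    have hpow : q ^ ((x + 1) * (x + 1 - 1)) = q ^ (x * (x - 1)) * (q ^ x) ^ 2 := by
      rw [← pow_mul, ← pow_add]
      congr 1
      rcases x with _ | k
      · rfl
      · simp only [Nat.add_sub_cancel]; ring
    rw [qPoch_succ, hpow, show 2 * (x + 1) = 2 * x + 2 by ring, pow_add]
    rw [qPoch_succ] at ih
    calc _ = ((1 - A * q ^ x) * hahnPoly q A B (q ^ (x + 1))⁻¹ (q ^ n)⁻¹ n) ^ 2 *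
          (qPoch A q x * qPoch B q z) ^ 2 := by ring_nf
      _ = (A * q ^ x) ^ 2 * (hahnPoly q A B (q ^ x)⁻¹ (q ^ n)⁻¹ n ^ 2 *
          (qPoch A q x * (qPoch B q z * (1 - B * q ^ z))) ^ 2) := by rw [hlow2]; ring
      _ = _ := by rw [ih]; ring

include hq0 hq1 ha hb in
-- The norm of a lowest weight vector. By `hahnPoly_top_sq` every summand is one constant times a
-- summand of `qVandermonde`, and `eta` is exactly the value of the sum.
theorem sum_qHahnHat_top (n : ℕ) :
    ∑ p ∈ antidiagonal n, qHahnHat q n p.1 a b n * qHahnHat q n p.1 a b n = 1 := by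
  set A := q ^ (a + 1) with hA
  set B := q ^ (b + 1) with hB
  have hA1 : A < 1 := rpow_add_one_lt_one hq0 hq1 ha
  have hB1 : B < 1 := rpow_add_one_lt_one hq0 hq1 hb
  have hS1 : A * B / q < 1 := rpow_mul_rpow_div_lt_one hq0 hq1 ha hb
  have hA0 : 0 < A := Real.rpow_pos_of_pos hq0 _
  have hη := eta_pos hq0 hq1 ha hb n 0
  have hQn := qPoch_pos hq0 hq1 hq1 n
  have hAn := qPoch_pos hq0 hq1 hA1 n
  have hBn := qPoch_pos hq0 hq1 hB1 n
  have hSn := qPoch_pos hq0 hq1 hS1 n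
  set T := qPoch (A * B * q ^ (n - 1)) q n with hT
  -- At `N = n` the quotient of Pochhammer symbols in `AB` and `AB/q`, together with the ratio of
  -- linear factors, collapses to `T`, the numerator of the `q`-Vandermonde sum.
  have hηT : eta q n a b n * q ^ (n * (n + 1)) = T * qPoch q q n * qPoch A q n * qPoch B q n *
      A ^ n := by
    have h0 := eta_add (a := a) (b := b) hq0 n 0
    rw [← hA, ← hB] at h0
    have h1 : (1 - A * B / q) * qPoch (A * B) q (2 * n) =
        qPoch (A * B / q) q n * T * (1 - A * B / q * q ^ (2 * n)) := by
      have := one_sub_mul_qPoch (A * B / q) q (2 * n)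
      rw [div_mul_cancel₀ _ hq0.ne'] at this
      rw [this, two_mul, qPoch_add]
      congr 2
      rcases n with _ | n
      · simp [hT]
      · rw [hT, Nat.add_sub_cancel, pow_succ]
        congr 1
        field_simp
    have h2 := one_sub_mul_pow_pos hq0 hq1 hS1 (2 * n)
    simp only [add_zero, mul_zero, qPoch_zero, div_one] at h0
    rw [h0]
    generalize 1 - A * B / q * q ^ (2 * n) = D at h1 h2 ⊢
    generalize 1 - A * B / q = D' at h1 ⊢
    generalize qPoch (A * B / q) q n = P at h1 hSn ⊢
    generalize qPoch (A * B) q (2 * n) = P' at h1 ⊢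
    have hE : q ^ (n * (n + 1)) ≠ 0 := (pow_pos hq0 _).ne'
    generalize q ^ (n * (n + 1)) = E at hE ⊢
    field_simp
    linear_combination h1
  have hterm : ∀ p ∈ antidiagonal n, qHahnHat q n p.1 a b n * qHahnHat q n p.1 a b n =
      A ^ n * qPoch A q n * qPoch B q n * qPoch (q ^ n)⁻¹ q n ^ 2 / eta q n a b n *
      (q ^ (p.1 * (p.1 - 1)) * A ^ p.1 * qPoch (A * q ^ p.1) q p.2 *
        qPoch (B * q ^ p.2) q p.1 / (qPoch q q p.1 * qPoch q q p.2)) := by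
    rintro ⟨x, z⟩ hp
    have hp : x + z = n := mem_antidiagonal.1 hp
    have hsq := hahnPoly_top_sq (A := A) (B := B) hq0 hq1 x z hp
    simp only
    rw [qHahnHat_eq hq0 hq1 ha (by omega) le_rfl, mul_mul_mul_comm, Real.mul_self_sqrt, ← hA, ← hB]
    · have hω := omega_add (a := a) (b := b) hq0 x z
      have e1 := qPoch_eq_mul_tail A q (show x ≤ n by omega)
      have e2 := qPoch_eq_mul_tail B q (show z ≤ n by omega)
      rw [show n - x = z by omega] at e1
      rw [show n - z = x by omega] at e2
      rw [hp, ← hA, ← hB] at hω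
      have hx := qPoch_pos hq0 hq1 hA1 x
      have hz := qPoch_pos hq0 hq1 hB1 z
      have hx' := qPoch_pos hq0 hq1 hq1 x
      have hz' := qPoch_pos hq0 hq1 hq1 z
      have hP : hahnPoly q A B (q ^ x)⁻¹ (q ^ n)⁻¹ n * hahnPoly q A B (q ^ x)⁻¹ (q ^ n)⁻¹ n =
          A ^ (2 * x) * q ^ (x * (x - 1)) *
          (qPoch A q n * qPoch (q ^ n)⁻¹ q n * qPoch B q n) ^ 2 /
          (qPoch A q x * qPoch B q z) ^ 2 := by
        rw [eq_div_iff (by positivity), ← hsq]; ring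
      have hAn' : A ^ n = A ^ x * A ^ z := by rw [← pow_add, hp]
      rw [hP, hω, hAn', e1, e2, two_mul, pow_add A x x]
      rw [add_zero] at hη
      generalize eta q n a b n = η at hη ⊢
      field_simp
    · have := omega_pos hq0 hq1 ha hb x z
      rw [hp] at this
      rw [add_zero] at hη
      positivity
  rw [Finset.sum_congr rfl hterm, ← Finset.mul_sum, qVandermonde hq0 hq1]
  have hinv := qPoch_inv_pow_self hq0 n
  have hE : q ^ (n * (n + 1)) ≠ 0 := (pow_pos hq0 _).ne'
  rw [add_zero] at hη
  rw [div_mul_div_comm, div_eq_one_iff_eq (by positivity)]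
  refine mul_right_cancel₀ hE ?_
  linear_combination A ^ n * qPoch A q n * qPoch B q n * T * hinv - qPoch q q n * hηT

include hq0 hq1 ha hb in
-- Adjointness of the coproducts of `A_+` and `A_-`: raise the vector of degree `n` from level `N`,
-- move the operator across the inner product by reindexing, and lower the vector of degree `n'`
-- from level `N + 1`. The boundary terms carry `σ_0 = 0`.
theorem sum_qHahnHat_succ {n n' r r' N : ℕ} (h : n + r = N) (h' : n' + r' = N + 1) :
    √(sigma q (a + b + 1 + 2 * n) (r + 1)) *
        ∑ p ∈ antidiagonal (N + 1), qHahnHat q n p.1 a b (N + 1 : ℕ) *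
          qHahnHat q n' p.1 a b (N + 1 : ℕ) =
      √(sigma q (a + b + 1 + 2 * n') r') *
        ∑ p ∈ antidiagonal N, qHahnHat q n p.1 a b N * qHahnHat q n' p.1 a b N := by
  have hterm : ∀ p ∈ antidiagonal (N + 1), √(sigma q (a + b + 1 + 2 * n) (r + 1)) *
      (qHahnHat q n p.1 a b (N + 1 : ℕ) * qHahnHat q n' p.1 a b (N + 1 : ℕ)) =
      √(sigma q a p.1) * qHahnHat q n ((p.1 : ℤ) - 1) a b N * qHahnHat q n' p.1 a b (N + 1 : ℕ) +
      q ^ ((p.1 : ℝ) + (a + 1) / 2) * √(sigma q b p.2) * qHahnHat q n p.1 a b N *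
        qHahnHat q n' p.1 a b (N + 1 : ℕ) := by
    rintro ⟨x, z⟩ hp
    have hp : x + z = N + 1 := mem_antidiagonal.1 hp
    have := qHahnHat_raise hq0 hq1 ha hb (n := n) (r := r) (x := x) (z := z) (by omega)
    rw [h] at this
    simp only
    rw [← mul_assoc, ← this]
    ring
  rw [Finset.mul_sum, Finset.sum_congr rfl hterm, Finset.sum_add_distrib,
    Finset.Nat.sum_antidiagonal_succ, Finset.Nat.sum_antidiagonal_succ']
  simp only [sigma_zero, Real.sqrt_zero, zero_mul, mul_zero, zero_add]
  rw [← Finset.sum_add_distrib, Finset.mul_sum]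
  refine Finset.sum_congr rfl ?_
  rintro ⟨x, z⟩ hp
  have hp : x + z = N := mem_antidiagonal.1 hp
  have := qHahnHat_lower hq0 hq1 ha hb (n := n') (r := r') (x := x) (z := z) (by omega)
  rw [hp] at this
  simp only
  rw [show (((x + 1 : ℕ) : ℤ) - 1) = (x : ℤ) by push_cast; ring]
  linear_combination qHahnHat q n x a b N * this

include hq0 hq1 ha hb in
-- Induction on `N`. Ordering `n ≤ n'` ensures that either the vector of degree `n` is already
-- present at the previous level and can be raised, or `n = n'` is the top degree.
theorem sum_qHahnHat_of_le {n n' N : ℕ} (h : n ≤ n') (h' : n' ≤ N) :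
    ∑ p ∈ antidiagonal N, qHahnHat q n p.1 a b N * qHahnHat q n' p.1 a b N =
      if n = n' then 1 else 0 := by
  have hc : ∀ n : ℕ, 0 < a + b + 1 + 2 * (n : ℝ) := fun n => by positivity
  induction N with
  | zero =>
    obtain rfl : n' = 0 := by omega
    obtain rfl : n = 0 := by omega
    rw [if_pos rfl]
    exact sum_qHahnHat_top hq0 hq1 ha hb 0
  | succ N ih =>
    rcases Nat.lt_or_ge N n with hn | hn
    · obtain rfl : n = N + 1 := by omega
      obtain rfl : n' = N + 1 := by omega
      rw [if_pos rfl]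
      exact sum_qHahnHat_top hq0 hq1 ha hb (N + 1)
    · obtain ⟨r, rfl⟩ := Nat.exists_eq_add_of_le hn
      have hpos := Real.sqrt_pos.2 (sigma_succ_pos hq0 hq1 (hc n) r)
      obtain ⟨r', hr'⟩ := Nat.exists_eq_add_of_le h'
      have hs := sum_qHahnHat_succ hq0 hq1 ha hb (n := n) (n' := n') (r := r) (r' := r') rfl
        (by omega)
      refine mul_left_cancel₀ hpos.ne' ?_
      rw [hs]
      -- For `r' = 0` the vector of degree `n'` has lowest weight and is killed by `A_-`, so it is
      -- orthogonal to the raised vector of smaller degree.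
      rcases r' with _ | r'
      · rw [if_neg (by omega)]
        simp
      · rw [ih (by omega)]
        split_ifs with hnn
        · subst hnn
          obtain rfl : r = r' := by omega
          rfl
        · simp

include hq0 hq1 ha hb in
theorem sum_qHahnHat_mul {n n' N : ℕ} (h : n ≤ N) (h' : n' ≤ N) :
    ∑ p ∈ antidiagonal N, qHahnHat q n p.1 a b N * qHahnHat q n' p.1 a b N =
      if n = n' then 1 else 0 := by
  rcases le_total n n' with hn | hn
  · exact sum_qHahnHat_of_le hq0 hq1 ha hb hn h'
  · rw [Finset.sum_congr rfl fun p _ => mul_comm _ _, sum_qHahnHat_of_le hq0 hq1 ha hb hn h]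
    simp only [eq_comm]

end

/-! ### The operators in the direct-product basis -/

section
variable {d : ℕ}

theorem map_e (f : Fin d → Module.End ℂ V) (c : Fin d → ℕ → ℂ) (g : Fin d → ℕ → ℕ)
    (hf : ∀ l n, f l (eV n) = c l n • eV (g l n)) (y : Fin d → ℕ) :
    PiTensorProduct.map f (e d y) = (∏ l, c l (y l)) • e d fun l => g l (y l) := by
  rw [e_apply, e_apply, PiTensorProduct.map_tprod]
  simp only [hf]
  exact MultilinearMap.map_smul_univ _ _ _

theorem qA0_eV (q s α : ℝ) (n : ℕ) :
    qA0 q s α (eV n) = ((q ^ (s * ((n : ℝ) + (α + 1) / 2)) : ℝ) : ℂ) • eV n := by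
  rw [qA0, Module.Basis.constr_basis]

theorem qA0Set_singleton_e (q s : ℝ) (α : Fin d → ℝ) (k : Fin d) (y : Fin d → ℕ) :
    qA0Set q s α {k} (e d y) =
      ((q ^ (s * ((y k : ℝ) + (α k + 1) / 2)) : ℝ) : ℂ) • e d y := by
  rw [qA0Set, map_e _
    (fun l n => if l = k then ((q ^ (s * ((n : ℝ) + (α l + 1) / 2)) : ℝ) : ℂ) else 1)
    (fun _ n => n)]
  · simp [Finset.prod_ite_eq']
  · intro l n
    by_cases h : l = k
    · simp [h, qA0_eV]
    · simp [h]

theorem site_e (k : Fin d) (A : Module.End ℂ V) (c : ℕ → ℂ) (g : ℕ → ℕ)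
    (hA : ∀ n, A (eV n) = c n • eV (g n)) (y : Fin d → ℕ) :
    site k A (e d y) = c (y k) • e d (update y k (g (y k))) := by
  rw [site, map_e _ (fun l n => if l = k then c n else 1) (fun l n => if l = k then g n else n)]
  · congr 1
    · simp [Finset.prod_ite_eq']
    · congr 1
      ext l
      by_cases h : l = k
      · subst h; simp
      · simp [h]
  · intro l n
    by_cases h : l = k
    · simp [h, hA]
    · simp [h]

/-! ### Splitting a block of tensor factors at its last or first site -/

theorem qA0Set_empty (q s : ℝ) (α : Fin d → ℝ) : qA0Set q s α ∅ = 1 := by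
  simp only [qA0Set, Finset.notMem_empty, if_false]
  exact PiTensorProduct.map_id

theorem qA0Set_union (q s : ℝ) (α : Fin d → ℝ) {S T : Finset (Fin d)} (h : Disjoint S T) :
    qA0Set q s α (S ∪ T) = qA0Set q s α S * qA0Set q s α T := by
  rw [qA0Set, qA0Set, qA0Set, ← PiTensorProduct.map_mul]
  congr 1
  funext l
  by_cases hS : l ∈ S
  · have : l ∉ T := Finset.disjoint_left.1 h hS
    simp only [Finset.mem_union, hS, this, true_or, if_true, if_false]
    rfl
  · simp only [Finset.mem_union, hS, false_or, if_false]
    rfl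

theorem mem_interval {i j : ℕ} {k : Fin d} :
    k ∈ interval d i j ↔ i ≤ (k : ℕ) + 1 ∧ (k : ℕ) + 1 ≤ j := by
  simp [interval]

theorem interval_succ {i : ℕ} (k : Fin d) (hi : i ≤ (k : ℕ) + 1) :
    interval d i (k + 1) = interval d i k ∪ {k} := by
  ext l
  simp only [mem_interval, Finset.mem_union, Finset.mem_singleton, Fin.ext_iff]
  omega

theorem disjoint_interval_singleton (i : ℕ) (k : Fin d) : Disjoint (interval d i k) {k} := by
  rw [Finset.disjoint_singleton_right, mem_interval]
  omega

theorem interval_one (z : Fin d) (hz : (z : ℕ) = 0) {j : ℕ} (hj : 1 ≤ j) :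
    interval d 1 j = {z} ∪ interval d 2 j := by
  ext l
  simp only [mem_interval, Finset.mem_union, Finset.mem_singleton, Fin.ext_iff]
  omega

theorem disjoint_singleton_interval (z : Fin d) (hz : (z : ℕ) = 0) (j : ℕ) :
    Disjoint {z} (interval d 2 j) := by
  rw [Finset.disjoint_singleton_left, mem_interval]
  omega

theorem interval_eq_empty {i j : ℕ} (h : j < i) : interval d i j = ∅ := by
  ext l
  simp only [mem_interval, Finset.notMem_empty, iff_false]
  omega

theorem qA0Set_interval_succ (q s : ℝ) (α : Fin d → ℝ) {i : ℕ} (k : Fin d)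
    (hi : i ≤ (k : ℕ) + 1) :
    qA0Set q s α (interval d i (k + 1)) = qA0Set q s α (interval d i k) * qA0Set q s α {k} := by
  rw [interval_succ k hi, qA0Set_union _ _ _ (disjoint_interval_singleton i k)]

theorem qA0Set_interval_one (q s : ℝ) (α : Fin d → ℝ) (z : Fin d) (hz : (z : ℕ) = 0) {j : ℕ}
    (hj : 1 ≤ j) :
    qA0Set q s α (interval d 1 j) = qA0Set q s α {z} * qA0Set q s α (interval d 2 j) := by
  rw [interval_one z hz hj, qA0Set_union _ _ _ (disjoint_singleton_interval z hz j)]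

/-- The twisted sum `∑_k q^{A_0^{(i)} + ⋯ + A_0^{(k-1)}} B^{(k)}` over the factors `[i;j]`. -/
def twistedSum (q : ℝ) (α : Fin d → ℝ) (B : Fin d → Module.End ℂ (W d)) (i j : ℕ) :
    Module.End ℂ (W d) :=
  ∑ k ∈ interval d i j, qA0Set q 1 α (interval d i k) * B k

/-- Coassociativity: the last factor splits off in the shape `A₁ + K₁ A₂` that `Ladder.couple`
expects, with `K₁ = q^{A_0}` of the preceding block. -/
theorem twistedSum_succ (q : ℝ) (α : Fin d → ℝ) (B : Fin d → Module.End ℂ (W d)) {i : ℕ}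
    (k : Fin d) (hi : i ≤ (k : ℕ) + 1) :
    twistedSum q α B i (k + 1) =
      twistedSum q α B i k + qA0Set q 1 α (interval d i k) * B k := by
  rw [twistedSum, interval_succ k hi, Finset.sum_union (disjoint_interval_singleton i k),
    Finset.sum_singleton, twistedSum]

/-- The splitting at the other end: every later term contains `q^{A_0^{(1)}}`, so `[2;j]` appears as
the right member of a coupling with factor `1`. -/
theorem twistedSum_one (q : ℝ) (α : Fin d → ℝ) (B : Fin d → Module.End ℂ (W d))
    (z : Fin d) (hz : (z : ℕ) = 0) {j : ℕ} (hj : 1 ≤ j) :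
    twistedSum q α B 1 j = B z + qA0Set q 1 α {z} * twistedSum q α B 2 j := by
  rw [twistedSum, interval_one z hz hj, Finset.sum_union (disjoint_singleton_interval z hz j),
    Finset.sum_singleton, twistedSum, Finset.mul_sum, interval_eq_empty (by omega), qA0Set_empty,
    one_mul]
  congr 1
  refine Finset.sum_congr rfl fun k hk => ?_
  rw [mem_interval] at hk
  rw [qA0Set_interval_one q 1 α z hz (by omega), mul_assoc]

theorem twistedSum_self (q : ℝ) (α : Fin d → ℝ) (B : Fin d → Module.End ℂ (W d)) {i : ℕ}
    (k : Fin d) (hk : i = (k : ℕ) + 1) : twistedSum q α B i i = B k := by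
  subst hk
  rw [twistedSum_succ _ _ _ k le_rfl, interval_eq_empty (by omega), qA0Set_empty, one_mul,
    twistedSum, interval_eq_empty (by omega), Finset.sum_empty, zero_add]

end

/-! ### Families of vectors on which `su_q(1,1)` acts at one label -/

section
variable {ι : Type*} [DecidableEq ι] {E : Type*} [AddCommGroup E] [Module ℂ E]

/-- The operators `K = q^{A_0}`, `K' = q^{-A_0}`, `A_+`, `A_-` act on the family `F` as in
`V^{(a)}`, the label `s p` being the level. -/
structure Ladder (q : ℝ) (K K' Ap Am : Module.End ℂ E) (p : ι) (a : (ι → ℕ) → ℝ)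
    (F : (ι → ℕ) → E) : Prop where
  weight : ∀ s, K (F s) = ((q ^ ((s p : ℝ) + (a s + 1) / 2) : ℝ) : ℂ) • F s
  weight_inv : ∀ s, K' (F s) = ((q ^ (-((s p : ℝ) + (a s + 1) / 2)) : ℝ) : ℂ) • F s
  raise : ∀ s, Ap (F s) = ((√(sigma q (a s) (s p + 1)) : ℝ) : ℂ) • F (update s p (s p + 1))
  lower : ∀ s, Am (F s) = ((√(sigma q (a s) (s p)) : ℝ) : ℂ) • F (update s p (s p - 1))

/-- `a` does not depend on the label at `p`. -/
def IndepAt {R : Type*} (a : (ι → ℕ) → R) (p : ι) : Prop := ∀ s v, a (update s p v) = a s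

/-- The Casimir element in terms of `q^{A_0}`, `q^{-A_0}`, `A_+`, `A_-`. -/
def casimirOf (q : ℝ) (K K' Ap Am : Module.End ℂ E) : Module.End ℂ E :=
  (((q ^ (1 / 2 : ℝ) - q ^ (-1 / 2 : ℝ)) ^ 2 : ℝ) : ℂ)⁻¹ •
      (((q ^ (-1 / 2 : ℝ) : ℝ) : ℂ) • K + ((q ^ (1 / 2 : ℝ) : ℝ) : ℂ) • K') -
    Ap * Am * ((q : ℂ) • K')

/-- The left side is the Casimir on the vector of level `n`; the dependence on `n` cancels. In the
variables `q^{1/2}`, `q^{a/2}` and `q^n` the identity is rational. -/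
theorem gamma_eq_casimir {q : ℝ} (hq0 : 0 < q) (hq1 : q < 1) (a : ℝ) (n : ℕ) :
    ((q ^ (1 / 2 : ℝ) - q ^ (-1 / 2 : ℝ)) ^ 2)⁻¹ *
        (q ^ (-1 / 2 : ℝ) * q ^ ((n : ℝ) + (a + 1) / 2) +
          q ^ (1 / 2 : ℝ) * q ^ (-((n : ℝ) + (a + 1) / 2))) -
      q * q ^ (-((n : ℝ) + (a + 1) / 2)) * sigma q a n = gamma q a := by
  set r := q ^ (1 / 2 : ℝ) with hr
  set c := q ^ (a / 2) with hc
  have hr0 : 0 < r := Real.rpow_pos_of_pos hq0 _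
  have hc0 : 0 < c := Real.rpow_pos_of_pos hq0 _
  have hqr : q = r ^ 2 := by
    rw [hr, ← Real.rpow_natCast, ← Real.rpow_mul hq0.le]; norm_num
  have h1 : q ^ (-1 / 2 : ℝ) = r⁻¹ := by
    rw [hr, ← Real.rpow_neg hq0.le]; norm_num
  have h2 : q ^ ((n : ℝ) + (a + 1) / 2) = q ^ n * c * r := by
    rw [hc, hr, ← Real.rpow_natCast, ← Real.rpow_add hq0, ← Real.rpow_add hq0]
    congr 1; ring
  have h3 : q ^ (-((n : ℝ) + (a + 1) / 2)) = (q ^ n * c * r)⁻¹ := by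
    rw [Real.rpow_neg hq0.le, h2]
  have h4 : q ^ ((n : ℝ) + a) = q ^ n * c ^ 2 := by
    rw [hc, ← Real.rpow_natCast, ← Real.rpow_natCast, ← Real.rpow_mul hq0.le, ← Real.rpow_add hq0]
    congr 1; push_cast; ring
  have h5 : q ^ (-a / 2) = c⁻¹ := by
    rw [hc, ← Real.rpow_neg hq0.le]; congr 1; ring
  have hn : 0 < q ^ n := pow_pos hq0 n
  rw [gamma, sigma, h1, h2, h3, h4, h5, ← hr, ← hc]
  have hq : 1 - r ^ 2 ≠ 0 := by rw [← hqr]; linarith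
  generalize q ^ n = Q at hn ⊢
  rw [hqr]
  have h6 : r - r⁻¹ = -(1 - r ^ 2) / r := by field_simp; ring
  rw [h6]
  generalize hD : 1 - r ^ 2 = D at hq ⊢
  field_simp
  ring

theorem Ladder.casimir {q : ℝ} (hq0 : 0 < q) (hq1 : q < 1) {K K' Ap Am : Module.End ℂ E}
    {p : ι} {a : (ι → ℕ) → ℝ} {F : (ι → ℕ) → E} (h : Ladder q K K' Ap Am p a F)
    (hp : IndepAt a p) (ha : ∀ s, 0 < a s) (s : ι → ℕ) :
    casimirOf q K K' Ap Am (F s) = ((gamma q (a s) : ℝ) : ℂ) • F s := by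
  have hAA : Ap (Am (F s)) = ((sigma q (a s) (s p) : ℝ) : ℂ) • F s := by
    rw [h.lower, map_smul, h.raise, smul_smul, hp, Function.update_self, Function.update_idem]
    -- At level `0` the truncated `0 - 1` in `lower` is harmless because `σ_0 = 0`.
    rcases hs : s p with _ | n
    · simp
    · rw [Nat.add_sub_cancel, ← Complex.ofReal_mul,
        Real.mul_self_sqrt (sigma_nonneg hq0 hq1 (ha s) _), ← hs, Function.update_eq_self]
  simp only [casimirOf, LinearMap.sub_apply, LinearMap.smul_apply, LinearMap.add_apply,
    Module.End.mul_apply, h.weight, h.weight_inv, map_smul, hAA, smul_smul, ← add_smul,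
    ← sub_smul]
  congr 1
  rw [← gamma_eq_casimir hq0 hq1 (a s) (s p)]
  push_cast
  ring

end

/-! ### Coupling two labels -/

section
variable {ι : Type*} [DecidableEq ι] {E : Type*} [AddCommGroup E] [Module ℂ E]
  {q : ℝ} {p p' : ι} {a b : (ι → ℕ) → ℝ} {F : (ι → ℕ) → E}

/-- The multi-index `s` with the labels at `p` and `p'` set to `x` and `z`. -/
def update₂ (s : ι → ℕ) (p p' : ι) (x z : ℕ) : ι → ℕ := update (update s p x) p' z

theorem update₂_left (hpp : p ≠ p') (s : ι → ℕ) (x z : ℕ) : update₂ s p p' x z p = x := by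
  simp [update₂, hpp]

theorem update₂_right (s : ι → ℕ) (x z : ℕ) : update₂ s p p' x z p' = z := by
  simp [update₂]

theorem update₂_of_ne {t : ι} (h : t ≠ p) (h' : t ≠ p') (s : ι → ℕ) (x z : ℕ) :
    update₂ s p p' x z t = s t := by
  simp [update₂, h, h']

theorem update_update₂_left (hpp : p ≠ p') (s : ι → ℕ) (x z v : ℕ) :
    update (update₂ s p p' x z) p v = update₂ s p p' v z := by
  rw [update₂, Function.update_comm hpp.symm, Function.update_idem, update₂]

theorem update_update₂_right (s : ι → ℕ) (x z v : ℕ) :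
    update (update₂ s p p' x z) p' v = update₂ s p p' x v := by
  rw [update₂, Function.update_idem, update₂]

theorem update₂_update_right (hpp : p ≠ p') (s : ι → ℕ) (x z v : ℕ) :
    update₂ (update s p' v) p p' x z = update₂ s p p' x z := by
  rw [update₂, Function.update_comm hpp.symm, Function.update_idem, update₂]

theorem update₂_update_of_ne {t : ι} (h : t ≠ p) (h' : t ≠ p') (s : ι → ℕ) (x z v : ℕ) :
    update₂ (update s t v) p p' x z = update (update₂ s p p' x z) t v := by
  rw [update₂, Function.update_comm h, Function.update_comm h', update₂]

theorem IndepAt.update₂ {R : Type*} {a : (ι → ℕ) → R} (h : IndepAt a p) (h' : IndepAt a p')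
    (s : ι → ℕ) (x z : ℕ) : a (update₂ s p p' x z) = a s := by
  rw [SUq.update₂, h', h]

/-- The Clebsch–Gordan coupling of the labels at `p` and `p'`: the new label at `p` is the
degree of the `q`-Hahn function, the new label at `p'` the level in the coupled representation. -/
def couple (q : ℝ) (p p' : ι) (a b : (ι → ℕ) → ℝ) (F : (ι → ℕ) → E) (s : ι → ℕ) : E :=
  ∑ x ∈ antidiagonal (s p + s p'),
    ((qHahnHat q (s p) x.1 (a s) (b s) (s p + s p' : ℕ) : ℝ) : ℂ) • F (update₂ s p p' x.1 x.2)

theorem couple_eigen {Z : Module.End ℂ E} {c : (ι → ℕ) → ℂ} (hZ : ∀ s, Z (F s) = c s • F s)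
    (hc : IndepAt c p) (hc' : IndepAt c p') (s : ι → ℕ) :
    Z (couple q p p' a b F s) = c s • couple q p p' a b F s := by
  rw [couple, map_sum, Finset.smul_sum]
  refine Finset.sum_congr rfl fun x _ => ?_
  rw [map_smul, hZ, hc.update₂ hc', smul_comm]

/-- Operators at a third label commute with the coupling, because neither the Clebsch–Gordan
coefficients depend on that label nor its type on the coupled ones. -/
theorem Ladder.couple_of_ne {K K' Ap Am : Module.End ℂ E} {t : ι} {c : (ι → ℕ) → ℝ}
    (h : Ladder q K K' Ap Am t c F) (ht : t ≠ p) (ht' : t ≠ p') (hc : IndepAt c p)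
    (hc' : IndepAt c p') (ha : IndepAt a t) (hb : IndepAt b t) :
    Ladder q K K' Ap Am t c (couple q p p' a b F) where
  weight s := by
    rw [couple, map_sum, Finset.smul_sum]
    refine Finset.sum_congr rfl fun x _ => ?_
    rw [map_smul, h.weight, hc.update₂ hc', update₂_of_ne ht ht', smul_comm]
  weight_inv s := by
    rw [couple, map_sum, Finset.smul_sum]
    refine Finset.sum_congr rfl fun x _ => ?_
    rw [map_smul, h.weight_inv, hc.update₂ hc', update₂_of_ne ht ht', smul_comm]
  raise s := by
    rw [couple, couple, map_sum, Finset.smul_sum, Function.update_of_ne ht.symm,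
      Function.update_of_ne ht'.symm, ha, hb]
    refine Finset.sum_congr rfl fun x _ => ?_
    rw [map_smul, h.raise, hc.update₂ hc', update₂_of_ne ht ht', smul_comm,
      update₂_update_of_ne ht ht']
  lower s := by
    rw [couple, couple, map_sum, Finset.smul_sum, Function.update_of_ne ht.symm,
      Function.update_of_ne ht'.symm, ha, hb]
    refine Finset.sum_congr rfl fun x _ => ?_
    rw [map_smul, h.lower, hc.update₂ hc', update₂_of_ne ht ht', smul_comm,
      update₂_update_of_ne ht ht']

/-- The vector `Φ x z` receives contributions from `(x - 1, z)` and `(x, z - 1)`, which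
`qHahnHat_raise` adds up. Reindexing costs nothing, since the extra boundary terms carry `σ_0 = 0`.
-/
theorem sum_couple_raise (hq0 : 0 < q) (hq1 : q < 1) {a b : ℝ} (ha : 0 < a) (hb : 0 < b)
    (Φ : ℕ → ℕ → E) (n r : ℕ) :
    ∑ x ∈ antidiagonal (n + r), ((qHahnHat q n x.1 a b (n + r : ℕ) : ℝ) : ℂ) •
        (((√(sigma q a (x.1 + 1)) : ℝ) : ℂ) • Φ (x.1 + 1) x.2 +
          ((q ^ ((x.1 : ℝ) + (a + 1) / 2) * √(sigma q b (x.2 + 1)) : ℝ) : ℂ) • Φ x.1 (x.2 + 1)) =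
      ((√(sigma q (a + b + 1 + 2 * n) (r + 1)) : ℝ) : ℂ) •
        ∑ x ∈ antidiagonal (n + (r + 1)), ((qHahnHat q n x.1 a b (n + (r + 1) : ℕ) : ℝ) : ℂ) •
          Φ x.1 x.2 := by
  have hterm : ∀ x ∈ antidiagonal (n + r + 1),
      ((√(sigma q (a + b + 1 + 2 * n) (r + 1)) : ℝ) : ℂ) •
        ((qHahnHat q n x.1 a b (n + r + 1 : ℕ) : ℝ) : ℂ) • Φ x.1 x.2 =
      ((√(sigma q a x.1) * qHahnHat q n ((x.1 : ℤ) - 1) a b ((n + r : ℕ) : ℤ) : ℝ) : ℂ) •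
        Φ x.1 x.2 +
      ((q ^ ((x.1 : ℝ) + (a + 1) / 2) * √(sigma q b x.2) *
        qHahnHat q n x.1 a b ((n + r : ℕ) : ℤ) : ℝ) : ℂ) • Φ x.1 x.2 := by
    rintro ⟨x, z⟩ hx
    have hx : x + z = n + r + 1 := mem_antidiagonal.1 hx
    rw [smul_smul, ← Complex.ofReal_mul, ← qHahnHat_raise hq0 hq1 ha hb hx, Complex.ofReal_add,
      add_smul]
  rw [← add_assoc n r 1, Finset.smul_sum, Finset.sum_congr rfl hterm, Finset.sum_add_distrib,
    Finset.Nat.sum_antidiagonal_succ, Finset.Nat.sum_antidiagonal_succ']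
  simp only [sigma_zero, Real.sqrt_zero, zero_mul, mul_zero, zero_add, Complex.ofReal_zero,
    zero_smul]
  rw [← Finset.sum_add_distrib]
  refine Finset.sum_congr rfl fun x _ => ?_
  rw [smul_add, smul_smul, smul_smul, ← Complex.ofReal_mul, ← Complex.ofReal_mul,
    show (((x.1 + 1 : ℕ) : ℤ) - 1) = (x.1 : ℤ) by push_cast; ring, mul_comm, mul_comm (_ * _)]

theorem sum_couple_lower (hq0 : 0 < q) (hq1 : q < 1) {a b : ℝ} (ha : 0 < a) (hb : 0 < b)
    (Φ : ℕ → ℕ → E) (n r : ℕ) :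
    ∑ x ∈ antidiagonal (n + r), ((qHahnHat q n x.1 a b (n + r : ℕ) : ℝ) : ℂ) •
        (((√(sigma q a x.1) : ℝ) : ℂ) • Φ (x.1 - 1) x.2 +
          ((q ^ ((x.1 : ℝ) + (a + 1) / 2) * √(sigma q b x.2) : ℝ) : ℂ) • Φ x.1 (x.2 - 1)) =
      ((√(sigma q (a + b + 1 + 2 * n) r) : ℝ) : ℂ) •
        ∑ x ∈ antidiagonal (n + (r - 1)), ((qHahnHat q n x.1 a b (n + (r - 1) : ℕ) : ℝ) : ℂ) •
          Φ x.1 x.2 := by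
  rcases hN : n + r with _ | N
  · obtain rfl : r = 0 := by omega
    simp
  simp only [smul_add, Finset.sum_add_distrib]
  rw [Finset.Nat.sum_antidiagonal_succ, Finset.Nat.sum_antidiagonal_succ']
  simp only [sigma_zero, Real.sqrt_zero, mul_zero, zero_add, Complex.ofReal_zero, zero_smul,
    smul_zero, Nat.add_sub_cancel]
  rw [← Finset.sum_add_distrib]
  have hterm : ∀ x ∈ antidiagonal N,
      ((qHahnHat q n ((x.1 + 1 : ℕ) : ℤ) a b ((N + 1 : ℕ) : ℤ) : ℝ) : ℂ) •
        ((√(sigma q a (x.1 + 1)) : ℝ) : ℂ) • Φ x.1 x.2 +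
      ((qHahnHat q n x.1 a b ((N + 1 : ℕ) : ℤ) : ℝ) : ℂ) •
        ((q ^ ((x.1 : ℝ) + (a + 1) / 2) * √(sigma q b (x.2 + 1)) : ℝ) : ℂ) • Φ x.1 x.2 =
      ((√(sigma q (a + b + 1 + 2 * n) r) : ℝ) : ℂ) •
        ((qHahnHat q n x.1 a b (N : ℕ) : ℝ) : ℂ) • Φ x.1 x.2 := by
    rintro ⟨x, z⟩ hx
    have hx : x + z = N := mem_antidiagonal.1 hx
    have h := qHahnHat_lower hq0 hq1 ha hb (n := n) (r := r) (x := x) (z := z) (by omega)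
    rw [hx] at h
    simp only [smul_smul, ← add_smul, ← Complex.ofReal_mul, ← Complex.ofReal_add]
    rw [← h]
    congr 2
    ring
  rw [Finset.sum_congr rfl hterm, Finset.smul_sum]
  -- For `r = 0` the sum on the right runs over the wrong antidiagonal because `r - 1` is truncated,
  -- but its coefficient is `√σ_0 = 0`.
  rcases r with _ | r
  · simp
  · rw [Nat.add_sub_cancel, show n + r = N by omega]

/-- The Clebsch–Gordan decomposition: the summand of degree `n` has type `a + b + 1 + 2n`. The types
are functions of the labels so that the result, whose type involves the new label `s p`, can be
coupled again. -/
theorem Ladder.couple (hq0 : 0 < q) (hq1 : q < 1) (hpp : p ≠ p')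
    {K₁ K₁' Ap₁ Am₁ K₂ K₂' Ap₂ Am₂ : Module.End ℂ E}
    (h₁ : Ladder q K₁ K₁' Ap₁ Am₁ p a F) (h₂ : Ladder q K₂ K₂' Ap₂ Am₂ p' b F)
    (ha : ∀ s, 0 < a s) (hb : ∀ s, 0 < b s) (hap : IndepAt a p) (hap' : IndepAt a p')
    (hbp : IndepAt b p) (hbp' : IndepAt b p') :
    Ladder q (K₁ * K₂) (K₁' * K₂') (Ap₁ + K₁ * Ap₂) (Am₁ + K₁ * Am₂) p'
      (fun s => a s + b s + 1 + 2 * (s p : ℝ)) (SUq.couple q p p' a b F) where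
  weight s := by
    rw [SUq.couple, map_sum, Finset.smul_sum]
    refine Finset.sum_congr rfl fun x hx => ?_
    have hx := mem_antidiagonal.1 hx
    have hxr : (x.1 : ℝ) + x.2 = s p + s p' := by exact_mod_cast hx
    have hq : q ^ ((x.1 : ℝ) + (a s + 1) / 2) * q ^ ((x.2 : ℝ) + (b s + 1) / 2) =
        q ^ ((s p' : ℝ) + (a s + b s + 1 + 2 * (s p : ℝ) + 1) / 2) := by
      rw [← Real.rpow_add hq0]
      congr 1
      linear_combination hxr
    rw [map_smul, Module.End.mul_apply, h₂.weight, map_smul, h₁.weight, hap.update₂ hap',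
      hbp.update₂ hbp', update₂_left hpp, update₂_right, smul_smul, smul_smul, smul_smul, ← hq]
    congr 1
    push_cast
    ring
  weight_inv s := by
    rw [SUq.couple, map_sum, Finset.smul_sum]
    refine Finset.sum_congr rfl fun x hx => ?_
    have hx := mem_antidiagonal.1 hx
    have hxr : (x.1 : ℝ) + x.2 = s p + s p' := by exact_mod_cast hx
    have hq : q ^ (-((x.1 : ℝ) + (a s + 1) / 2)) * q ^ (-((x.2 : ℝ) + (b s + 1) / 2)) =
        q ^ (-((s p' : ℝ) + (a s + b s + 1 + 2 * (s p : ℝ) + 1) / 2)) := by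
      rw [← Real.rpow_add hq0]
      congr 1
      linear_combination -hxr
    rw [map_smul, Module.End.mul_apply, h₂.weight_inv, map_smul, h₁.weight_inv, hap.update₂ hap',
      hbp.update₂ hbp', update₂_left hpp, update₂_right, smul_smul, smul_smul, smul_smul, ← hq]
    congr 1
    push_cast
    ring
  raise s := by
    have := sum_couple_raise hq0 hq1 (ha s) (hb s) (fun x z => F (update₂ s p p' x z)) (s p) (s p')
    rw [SUq.couple, SUq.couple, Function.update_self, Function.update_of_ne hpp, hap', hbp']
    simp only [update₂_update_right hpp]
    rw [← this, map_sum]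
    refine Finset.sum_congr rfl fun x _ => ?_
    rw [map_smul, LinearMap.add_apply, Module.End.mul_apply, h₁.raise, h₂.raise, map_smul,
      h₁.weight, hap.update₂ hap', hbp.update₂ hbp', update₂_left hpp, update₂_right,
      update_update₂_left hpp, update_update₂_right, hap.update₂ hap', update₂_left hpp, smul_smul,
      mul_comm ((√_ : ℝ) : ℂ), ← Complex.ofReal_mul]
  lower s := by
    have := sum_couple_lower hq0 hq1 (ha s) (hb s) (fun x z => F (update₂ s p p' x z)) (s p) (s p')
    rw [SUq.couple, SUq.couple, Function.update_self, Function.update_of_ne hpp, hap', hbp']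
    simp only [update₂_update_right hpp]
    rw [← this, map_sum]
    refine Finset.sum_congr rfl fun x _ => ?_
    rw [map_smul, LinearMap.add_apply, Module.End.mul_apply, h₁.lower, h₂.lower, map_smul,
      h₁.weight, hap.update₂ hap', hbp.update₂ hbp', update₂_left hpp, update₂_right,
      update_update₂_left hpp, update_update₂_right, hap.update₂ hap', update₂_left hpp, smul_smul,
      mul_comm ((√_ : ℝ) : ℂ), ← Complex.ofReal_mul]

end

/-! ### The inner product -/

section
variable {d : ℕ}

theorem ip_eq_sum (v w : W d) {S : Finset (Fin d → ℕ)} (hS : ((e d).repr v).support ⊆ S) :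
    ip v w = ∑ y ∈ S, (starRingEnd ℂ) ((e d).repr v y) * (e d).repr w y :=
  Finsupp.sum_of_support_subset _ hS _ fun y _ => by simp

theorem ip_add_left (v v' w : W d) : ip (v + v') w = ip v w + ip v' w := by
  classical
  rw [ip_eq_sum v w (Finset.subset_union_left (s₂ := ((e d).repr v').support)),
    ip_eq_sum v' w (Finset.subset_union_right (s₁ := ((e d).repr v).support)),
    ip_eq_sum (v + v') w (S := ((e d).repr v).support ∪ ((e d).repr v').support)
      (by rw [map_add]; exact Finsupp.support_add), ← Finset.sum_add_distrib]
  refine Finset.sum_congr rfl fun y _ => ?_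
  rw [map_add, Finsupp.add_apply, map_add, add_mul]

theorem ip_smul_left (c : ℂ) (v w : W d) : ip (c • v) w = (starRingEnd ℂ) c * ip v w := by
  rw [ip_eq_sum v w subset_rfl,
    ip_eq_sum (c • v) w (S := ((e d).repr v).support) (by rw [map_smul]; exact Finsupp.support_smul), Finset.mul_sum]
  refine Finset.sum_congr rfl fun y _ => ?_
  rw [map_smul, Finsupp.smul_apply, smul_eq_mul, map_mul, mul_assoc]

theorem ip_add_right (v w w' : W d) : ip v (w + w') = ip v w + ip v w' := by
  rw [ip_eq_sum v _ subset_rfl, ip_eq_sum v _ subset_rfl, ip_eq_sum v _ subset_rfl,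
    ← Finset.sum_add_distrib]
  refine Finset.sum_congr rfl fun y _ => ?_
  rw [map_add, Finsupp.add_apply, mul_add]

theorem ip_smul_right (c : ℂ) (v w : W d) : ip v (c • w) = c * ip v w := by
  rw [ip_eq_sum v _ subset_rfl, ip_eq_sum v _ subset_rfl, Finset.mul_sum]
  refine Finset.sum_congr rfl fun y _ => ?_
  rw [map_smul, Finsupp.smul_apply, smul_eq_mul]
  ring

theorem ip_zero_left (w : W d) : ip 0 w = 0 := by
  simpa using ip_smul_left 0 (0 : W d) w

theorem ip_zero_right (v : W d) : ip v 0 = 0 := by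
  simpa using ip_smul_right 0 v (0 : W d)

theorem ip_sum_left {κ : Type*} (S : Finset κ) (c : κ → ℂ) (v : κ → W d) (w : W d) :
    ip (∑ i ∈ S, c i • v i) w = ∑ i ∈ S, (starRingEnd ℂ) (c i) * ip (v i) w := by
  classical
  induction S using Finset.induction_on with
  | empty => simp [ip_zero_left]
  | insert i S hi ih =>
    rw [Finset.sum_insert hi, Finset.sum_insert hi, ip_add_left, ip_smul_left, ih]

theorem ip_sum_right {κ : Type*} (S : Finset κ) (c : κ → ℂ) (v : W d) (w : κ → W d) :
    ip v (∑ i ∈ S, c i • w i) = ∑ i ∈ S, c i * ip v (w i) := by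
  classical
  induction S using Finset.induction_on with
  | empty => simp [ip_zero_right]
  | insert i S hi ih =>
    rw [Finset.sum_insert hi, Finset.sum_insert hi, ip_add_right, ip_smul_right, ih]

theorem ip_e_left (y : Fin d → ℕ) (w : W d) : ip (e d y) w = (e d).repr w y := by
  simp [ip]

theorem ip_e_e (y y' : Fin d → ℕ) : ip (e d y) (e d y') = if y = y' then 1 else 0 := by
  rw [ip_e_left, Module.Basis.repr_self, Finsupp.single_apply]
  simp only [eq_comm]

/-- The family `F` is orthonormal. -/
def IsOrthonormal (F : (Fin d → ℕ) → W d) : Prop :=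
  ∀ s s', ip (F s) (F s') = if s = s' then 1 else 0

theorem eq_of_update₂_eq {p p' : Fin d} {s s' : Fin d → ℕ} {x z x' z' : ℕ}
    (h : update₂ s p p' x z = update₂ s' p p' x' z') (t : Fin d) (ht : t ≠ p) (ht' : t ≠ p') :
    s t = s' t := by
  have := congrFun h t
  rwa [update₂_of_ne ht ht', update₂_of_ne ht ht'] at this

/-- The coupling matrix is block diagonal: it fixes the other labels and the sum `s p + s p'`.
Within a block the types are constant, and orthonormality is `sum_qHahnHat_mul`. -/
theorem IsOrthonormal.couple {q : ℝ} (hq0 : 0 < q) (hq1 : q < 1) {p p' : Fin d} (hpp : p ≠ p')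
    {a b : (Fin d → ℕ) → ℝ} {F : (Fin d → ℕ) → W d} (h : IsOrthonormal F)
    (ha : ∀ s, 0 < a s) (hb : ∀ s, 0 < b s) (hap : IndepAt a p) (hap' : IndepAt a p')
    (hbp : IndepAt b p) (hbp' : IndepAt b p') :
    IsOrthonormal (SUq.couple q p p' a b F) := by
  intro s s'
  have hexp : ip (SUq.couple q p p' a b F s) (SUq.couple q p p' a b F s') =
      ∑ x ∈ antidiagonal (s p + s p'), ∑ x' ∈ antidiagonal (s' p + s' p'),
        ((qHahnHat q (s p) x.1 (a s) (b s) (s p + s p' : ℕ) : ℝ) : ℂ) *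
        ((qHahnHat q (s' p) x'.1 (a s') (b s') (s' p + s' p' : ℕ) : ℝ) : ℂ) *
        if update₂ s p p' x.1 x.2 = update₂ s' p p' x'.1 x'.2 then 1 else 0 := by
    rw [SUq.couple, ip_sum_left]
    refine Finset.sum_congr rfl fun x _ => ?_
    rw [SUq.couple, ip_sum_right, Finset.mul_sum]
    refine Finset.sum_congr rfl fun x' _ => ?_
    rw [h, Complex.conj_ofReal, mul_assoc]
  rw [hexp]
  by_cases hoff : (∀ t, t ≠ p → t ≠ p' → s t = s' t) ∧ s p + s p' = s' p + s' p'
  · obtain ⟨hoff, hN⟩ := hoff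
    have hs' : s' = update₂ s p p' (s' p) (s' p') := by
      ext t
      by_cases h1 : t = p'
      · subst h1; rw [update₂_right]
      · by_cases h2 : t = p
        · subst h2; rw [update₂_left hpp]
        · rw [update₂_of_ne h2 h1, hoff t h2 h1]
    have hu : ∀ x z, update₂ s' p p' x z = update₂ s p p' x z := by
      intro x z
      ext t
      by_cases h1 : t = p'
      · subst h1; rw [update₂_right, update₂_right]
      · by_cases h2 : t = p
        · subst h2; rw [update₂_left hpp, update₂_left hpp]
        · rw [update₂_of_ne h2 h1, update₂_of_ne h2 h1, hoff t h2 h1]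
    have haa : a s' = a s := by rw [hs', hap.update₂ hap']
    have hbb : b s' = b s := by rw [hs', hbp.update₂ hbp']
    have hinj : ∀ x x' : ℕ × ℕ,
        update₂ s p p' x.1 x.2 = update₂ s p p' x'.1 x'.2 ↔ x = x' := by
      intro x x'
      refine ⟨fun H => Prod.ext ?_ ?_, fun H => by rw [H]⟩
      · simpa only [update₂_left hpp] using congrFun H p
      · simpa only [update₂_right] using congrFun H p'
    simp only [hu, hinj, haa, hbb, ← hN, mul_ite, mul_one, mul_zero, Finset.sum_ite_eq]
    rw [Finset.sum_congr rfl fun x hx => if_pos hx]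
    have := sum_qHahnHat_mul hq0 hq1 (ha s) (hb s) (n := s p) (n' := s' p) (N := s p + s p')
      (by omega) (by omega)
    rw [show (if s = s' then (1 : ℂ) else 0) = ((if s p = s' p then 1 else 0 : ℝ) : ℂ) by
      by_cases hn : s p = s' p
      · rw [if_pos hn, if_pos, Complex.ofReal_one]
        rw [hs', ← hn, show s' p' = s p' by omega]
        simp [update₂]
      · rw [if_neg hn, if_neg (fun H => hn (by rw [H])), Complex.ofReal_zero], ← this]
    push_cast
    rfl
  · rw [if_neg (by rintro rfl; exact hoff ⟨fun _ _ _ => rfl, rfl⟩)]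
    refine Finset.sum_eq_zero fun x hx => Finset.sum_eq_zero fun x' hx' => ?_
    rw [if_neg, mul_zero]
    intro H
    refine hoff ⟨eq_of_update₂_eq H, ?_⟩
    have h1 := congrFun H p
    have h2 := congrFun H p'
    rw [update₂_left hpp, update₂_left hpp] at h1
    rw [update₂_right, update₂_right] at h2
    rw [← mem_antidiagonal.1 hx, ← mem_antidiagonal.1 hx', h1, h2]

theorem repr_couple (q : ℝ) (p p' : Fin d) (a b : (Fin d → ℕ) → ℝ) (F : (Fin d → ℕ) → W d)
    (s y : Fin d → ℕ) :
    (e d).repr (couple q p p' a b F s) y = ∑ x ∈ antidiagonal (s p + s p'),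
      ((qHahnHat q (s p) x.1 (a s) (b s) (s p + s p' : ℕ) : ℝ) : ℂ) *
        (e d).repr (F (update₂ s p p' x.1 x.2)) y := by
  rw [couple, map_sum, Finsupp.finsetSum_apply]
  refine Finset.sum_congr rfl fun x _ => ?_
  rw [map_smul, Finsupp.smul_apply, smul_eq_mul]

end

/-! ### Entries and partial sums -/

section
variable {R : Type*} {d : ℕ}

theorem entry_val_succ [Zero R] (x : Fin d → R) (l : Fin d) : entry x (l + 1) = x l := by
  rw [entry, dif_pos ⟨by omega, by omega⟩]
  rfl

theorem entry_of_lt [Zero R] (x : Fin d → R) {k : ℕ} (h : d < k) : entry x k = 0 :=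
  dif_neg (by omega)

theorem entry_update_self [Zero R] (x : Fin d → R) (p : Fin d) (v : R) :
    entry (update x p v) (p + 1) = v := by
  rw [entry_val_succ, Function.update_self]

theorem entry_update_of_ne [Zero R] (x : Fin d → R) (p : Fin d) (v : R) {k : ℕ}
    (h : k ≠ p + 1) : entry (update x p v) k = entry x k := by
  unfold entry
  split_ifs with hk
  · rw [Function.update_of_ne]
    simp only [ne_eq, Fin.ext_iff]
    omega
  · rfl

theorem psum_of_lt [AddCommMonoid R] (x : Fin d → R) {i j : ℕ} (h : j < i) : psum x i j = 0 := by
  rw [psum, Finset.Icc_eq_empty (by omega), Finset.sum_empty]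

theorem psum_succ [AddCommMonoid R] (x : Fin d → R) {i j : ℕ} (h : i ≤ j + 1) :
    psum x i (j + 1) = psum x i j + entry x (j + 1) := by
  rw [psum, Finset.sum_Icc_succ_top h, psum]

theorem psum_one_eq [AddCommMonoid R] (x : Fin d → R) {j : ℕ} (h : 1 ≤ j) :
    psum x 1 j = entry x 1 + psum x 2 j := by
  induction j, h using Nat.le_induction with
  | base => rw [psum_succ _ le_rfl, psum_of_lt _ (by omega), psum_of_lt _ (by omega), zero_add,
      add_zero]
  | succ j hj ih => rw [psum_succ _ (by omega), ih, psum_succ _ (by omega), add_assoc]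

theorem psum_update [AddCommMonoid R] (x : Fin d → R) (p : Fin d) (v : R) {i j : ℕ}
    (h : (p : ℕ) + 1 < i ∨ j < p + 1) : psum (update x p v) i j = psum x i j := by
  refine Finset.sum_congr rfl fun k hk => entry_update_of_ne _ _ _ ?_
  rw [Finset.mem_Icc] at hk
  omega

theorem psum_pos {x : Fin d → ℝ} (hx : ∀ k, 0 < x k) {i j : ℕ} (hi : 1 ≤ i) (hij : i ≤ j)
    (hj : j ≤ d) : 0 < psum x i j := by
  refine Finset.sum_pos (fun k hk => ?_) ⟨i, Finset.mem_Icc.2 ⟨le_rfl, hij⟩⟩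
  rw [Finset.mem_Icc] at hk
  rw [entry, dif_pos ⟨by omega, by omega⟩]
  exact hx _

theorem ext_entry [Zero R] {x y : Fin d → R} (h : ∀ k, 1 ≤ k → k ≤ d → entry x k = entry y k) :
    x = y := by
  ext l
  rw [← entry_val_succ x, ← entry_val_succ y, h _ (by omega) (by omega)]

theorem sum_eq_psum [AddCommMonoid R] (x : Fin d → R) : ∑ l, x l = psum x 1 d := by
  rw [psum, ← Finset.Ico_add_one_right_eq_Icc, Finset.sum_Ico_eq_sum_range, Finset.sum_range]
  refine Finset.sum_congr rfl fun l _ => ?_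
  rw [add_comm 1 (l : ℕ), ← entry_val_succ x l]

end

/-! ### Coupling the factors `2, 3, …` successively -/

section
variable {d : ℕ} {q : ℝ} {α : Fin d → ℝ}

/-- The type of the representation obtained by coupling the factors `2, …, k + 2`. -/
def stageType (α : Fin d → ℝ) (k : ℕ) (s : Fin d → ℕ) : ℝ :=
  2 * ((psum s 2 (k + 1) : ℕ) : ℝ) + psum α 2 (k + 2) + k

/-- The basis obtained from the direct-product basis by coupling the factors `2, …, k + 2`. -/
def stage (q : ℝ) (α : Fin d → ℝ) : ℕ → (Fin d → ℕ) → W d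
  | 0 => e d
  | k + 1 => if h : k + 2 < d then
      couple q ⟨k + 1, by omega⟩ ⟨k + 2, h⟩ (stageType α k) (fun _ => α ⟨k + 2, h⟩) (stage q α k)
    else stage q α k

theorem stage_succ {k : ℕ} (h : k + 2 < d) : stage q α (k + 1) =
    couple q ⟨k + 1, by omega⟩ ⟨k + 2, h⟩ (stageType α k) (fun _ => α ⟨k + 2, h⟩)
      (stage q α k) := by
  rw [stage, dif_pos h]

theorem stageType_indep (α : Fin d → ℝ) (k : ℕ) (p : Fin d) (h : (p : ℕ) = 0 ∨ k + 1 ≤ p) :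
    IndepAt (stageType α k) p := by
  intro s v
  rw [stageType, psum_update _ _ _ (by omega), stageType]

theorem stageType_pos (hα : ∀ k, 0 < α k) {k : ℕ} (hk : k + 2 ≤ d) (s : Fin d → ℕ) :
    0 < stageType α k s := by
  have := psum_pos hα (i := 2) (j := k + 2) (by omega) (by omega) hk
  unfold stageType
  positivity

theorem stageType_succ {k : ℕ} (h : k + 2 < d) (s : Fin d → ℕ) :
    stageType α (k + 1) s =
      stageType α k s + α ⟨k + 2, h⟩ + 1 + 2 * ((s ⟨k + 1, by omega⟩ : ℕ) : ℝ) := by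
  unfold stageType
  rw [psum_succ s (show 2 ≤ k + 1 + 1 by omega), psum_succ α (show 2 ≤ k + 2 + 1 by omega),
    ← entry_val_succ s ⟨k + 1, by omega⟩, ← entry_val_succ α ⟨k + 2, h⟩]
  push_cast
  ring

theorem indepAt_const {ι R : Type*} [DecidableEq ι] (c : R) (p : ι) :
    IndepAt (fun _ : ι → ℕ => c) p := fun _ _ => rfl

theorem site_ladder (q : ℝ) (α : Fin d → ℝ) (l : Fin d) :
    Ladder q (qA0Set q 1 α {l}) (qA0Set q (-1) α {l}) (site l (Aplus q (α l)))
      (site l (Aminus q (α l))) l (fun _ => α l) (e d) where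
  weight s := by rw [qA0Set_singleton_e, one_mul]
  weight_inv s := by rw [qA0Set_singleton_e, neg_one_mul]
  raise s := site_e l _ (fun n => ((√(sigma q (α l) (n + 1)) : ℝ) : ℂ)) (fun n => n + 1)
    (fun n => by rw [Aplus, Module.Basis.constr_basis]) s
  lower s := site_e l _ (fun n => ((√(sigma q (α l) n) : ℝ) : ℂ)) (fun n => n - 1)
    (fun n => by rw [Aminus, Module.Basis.constr_basis]) s

theorem stage_site_ladder {k : ℕ} (hk : k + 1 < d) (l : Fin d) (hl : (l : ℕ) = 0 ∨ k + 2 ≤ l) :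
    Ladder q (qA0Set q 1 α {l}) (qA0Set q (-1) α {l}) (site l (Aplus q (α l)))
      (site l (Aminus q (α l))) l (fun _ => α l) (stage q α k) := by
  induction k with
  | zero => exact site_ladder q α l
  | succ k ih =>
    rw [stage_succ hk]
    refine (ih (by omega) (by omega)).couple_of_ne ?_ ?_ (indepAt_const _ _) (indepAt_const _ _)
      (stageType_indep _ _ _ (by omega)) (indepAt_const _ _)
    · simp only [ne_eq, Fin.ext_iff]; omega
    · simp only [ne_eq, Fin.ext_iff]; omega

/-- After `k` couplings the zero-based positions `1, …, k` hold the degrees, position `k + 1` holds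
the level of the block `[2;k+2]`, and all others still hold entries of `y`. -/
theorem stage_ladder (hq0 : 0 < q) (hq1 : q < 1) (hα : ∀ k, 0 < α k) {k : ℕ} (hk : k + 1 < d) :
    Ladder q (qA0Set q 1 α (interval d 2 (k + 2))) (qA0Set q (-1) α (interval d 2 (k + 2)))
      (AplusSet q α 2 (k + 2)) (AminusSet q α 2 (k + 2)) ⟨k + 1, hk⟩ (stageType α k)
      (stage q α k) := by
  induction k with
  | zero =>
    have h := site_ladder q α ⟨1, hk⟩
    have hi : interval d 2 (0 + 2) = {⟨1, hk⟩} := by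
      ext l
      simp only [mem_interval, Finset.mem_singleton, Fin.ext_iff]
      omega
    have ht : stageType α 0 = fun _ => α ⟨1, hk⟩ := by
      funext s
      rw [stageType, psum_of_lt _ (by omega), psum_succ _ (by omega), psum_of_lt _ (by omega),
        ← entry_val_succ α ⟨1, hk⟩]
      simp
    rw [hi, ht, stage]
    convert h using 1
    · exact twistedSum_self q α (fun k => site k (Aplus q (α k))) ⟨1, hk⟩ rfl
    · exact twistedSum_self q α (fun k => site k (Aminus q (α k))) ⟨1, hk⟩ rfl
  | succ k ih =>
    have h₁ := ih (by omega)
    have h₂ := stage_site_ladder (q := q) (α := α) (k := k) (by omega) ⟨k + 2, hk⟩ (Or.inr le_rfl)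
    have h := h₁.couple hq0 hq1 (by simp [Fin.ext_iff]) h₂ (stageType_pos hα (by omega))
      (fun _ => hα _) (stageType_indep _ _ _ (by simp)) (stageType_indep _ _ _ (by simp))
      (indepAt_const _ _) (indepAt_const _ _)
    rw [stage_succ hk, show stageType α (k + 1) = _ from funext fun s => stageType_succ hk s]
    convert h using 1
    · exact qA0Set_interval_succ q 1 α ⟨k + 2, hk⟩ (by simp)
    · exact qA0Set_interval_succ q (-1) α ⟨k + 2, hk⟩ (by simp)
    · exact twistedSum_succ q α (fun k => site k (Aplus q (α k))) ⟨k + 2, hk⟩ (by simp)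
    · exact twistedSum_succ q α (fun k => site k (Aminus q (α k))) ⟨k + 2, hk⟩ (by simp)

/-- When the block `[2;j+2]` has just been formed, its Casimir is the scalar of its type. Later
couplings only mix vectors with the same degrees at positions `1, …, j`, hence with the same
eigenvalue. -/
theorem stage_casimir (hq0 : 0 < q) (hq1 : q < 1) (hα : ∀ k, 0 < α k) {j k : ℕ} (hjk : j ≤ k)
    (hk : k + 1 < d) (s : Fin d → ℕ) :
    Casimir q α 2 (j + 2) (stage q α k s) =
      ((gamma q (stageType α j s) : ℝ) : ℂ) • stage q α k s := by
  induction k, hjk using Nat.le_induction generalizing s with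
  | base =>
    -- `Casimir` is definitionally `casimirOf` of the four operators of the block.
    exact (stage_ladder hq0 hq1 hα hk).casimir hq0 hq1 (stageType_indep _ _ _ (by simp))
      (stageType_pos hα (by omega)) s
  | succ k hjk ih =>
    rw [stage_succ hk]
    refine couple_eigen (c := fun s => ((gamma q (stageType α j s) : ℝ) : ℂ)) (ih (by omega)) ?_ ?_ s
    · intro s v
      beta_reduce
      rw [stageType_indep α j _ (by simp only; omega)]
    · intro s v
      beta_reduce
      rw [stageType_indep α j _ (by simp only; omega)]

theorem stage_orthonormal (hq0 : 0 < q) (hq1 : q < 1) (hα : ∀ k, 0 < α k) {k : ℕ}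
    (hk : k + 1 < d) : IsOrthonormal (stage q α k) := by
  induction k with
  | zero => exact ip_e_e
  | succ k ih =>
    rw [stage_succ hk]
    exact (ih (by omega)).couple hq0 hq1 (by simp [Fin.ext_iff]) (stageType_pos hα (by omega))
      (fun _ => hα _) (stageType_indep _ _ _ (by simp)) (stageType_indep _ _ _ (by simp))
      (indepAt_const _ _) (indepAt_const _ _)

/-- The factor contributed by the coupling of the factor `i + 2`. -/
def stageFactor (q : ℝ) (α : Fin d → ℝ) (s y : Fin d → ℕ) (i : ℕ) : ℝ :=
  qHahnHat q (entry s (i + 1)) ((psum y 2 (i + 1) : ℕ) - (psum s 2 i : ℕ))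
    (stageType α (i - 1) s) (entry α (i + 2)) ((psum y 2 (i + 2) : ℕ) - (psum s 2 i : ℕ))

theorem stageFactor_update₂ (s y : Fin d → ℕ) {p p' : Fin d} (x z : ℕ) {i : ℕ} (hi : 1 ≤ i)
    (hp : (p : ℕ) = 0 ∨ i + 1 ≤ p) (hp' : i + 1 ≤ p') :
    stageFactor q α (update₂ s p p' x z) y i = stageFactor q α s y i := by
  unfold stageFactor
  rw [(stageType_indep α (i - 1) p (by omega)).update₂ (stageType_indep α (i - 1) p' (by omega)),
    update₂, entry_update_of_ne _ _ _ (by omega), entry_update_of_ne _ _ _ (by omega),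
    psum_update _ _ _ (by omega), psum_update _ _ _ (by omega)]

open scoped Classical in
-- Each coupling preserves the labels not yet used and the total of labels `2, …, k + 2`. Against a
-- fixed `e_y` only one term of the coupling sum survives: `z` must be the new entry of `y`, and `x`
-- is then forced by the total.
theorem repr_stage {k : ℕ} (hk : k + 1 < d) (s y : Fin d → ℕ) :
    (e d).repr (stage q α k s) y =
      if entry s 1 = entry y 1 ∧ (∀ j, k + 3 ≤ j → entry s j = entry y j) ∧
          psum s 2 (k + 2) = psum y 2 (k + 2) then
        ((∏ i ∈ Finset.Icc 1 k, stageFactor q α s y i : ℝ) : ℂ) else 0 := by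
  induction k generalizing s with
  | zero =>
    rw [stage, Module.Basis.repr_self, Finsupp.single_apply]
    have h2 : ∀ x : Fin d → ℕ, psum x 2 (0 + 2) = entry x 2 := fun x => by
      rw [psum_succ _ (by omega), psum_of_lt _ (by omega), zero_add]
    rw [h2, h2]
    by_cases h : s = y
    · subst h; simp
    · rw [if_neg h, if_neg]
      rintro ⟨H1, H3, H2⟩
      refine h (ext_entry fun k hk hkd => ?_)
      rcases (show k = 1 ∨ k = 2 ∨ 3 ≤ k by omega) with rfl | rfl | hk3
      · exact H1
      · exact H2
      · exact H3 k (by omega)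
  | succ k ih =>
    have hpp : (⟨k + 1, by omega⟩ : Fin d) ≠ ⟨k + 2, hk⟩ := by simp [Fin.ext_iff]
    set p : Fin d := ⟨k + 1, by omega⟩ with hp
    set p' : Fin d := ⟨k + 2, hk⟩ with hp'
    set P := psum s 2 (k + 1) with hP
    have hsP : psum s 2 (k + 1 + 2) = P + s p + s p' := by
      rw [psum_succ s (by omega), psum_succ s (by omega), ← entry_val_succ s p,
        ← entry_val_succ s p']
    have hyP : psum y 2 (k + 1 + 2) = psum y 2 (k + 2) + entry y (k + 3) := by
      rw [psum_succ y (by omega)]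
    have hterm : ∀ x z : ℕ, (e d).repr (stage q α k (update₂ s p p' x z)) y =
        if entry s 1 = entry y 1 ∧ (∀ j, k + 4 ≤ j → entry s j = entry y j) ∧
          z = entry y (k + 3) ∧ P + x = psum y 2 (k + 2) then
        ((∏ i ∈ Finset.Icc 1 k, stageFactor q α s y i : ℝ) : ℂ) else 0 := by
      intro x z
      have e1 : entry (update₂ s p p' x z) 1 = entry s 1 := by
        rw [update₂, entry_update_of_ne _ _ _ (by simp [hp']),
          entry_update_of_ne _ _ _ (by simp [hp])]
      have e2 : psum (update₂ s p p' x z) 2 (k + 2) = P + x := by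
        rw [update₂, psum_update _ _ _ (by simp [hp']), psum_succ _ (by omega),
          psum_update _ _ _ (by simp [hp]), show k + 1 + 1 = (p : ℕ) + 1 from rfl,
          entry_update_self]
      have e3 : entry (update₂ s p p' x z) (k + 3) = z := by
        rw [update₂, show k + 3 = (p' : ℕ) + 1 from rfl, entry_update_self]
      have e4 : ∀ j, k + 4 ≤ j → entry (update₂ s p p' x z) j = entry s j := by
        intro j hj
        rw [update₂, entry_update_of_ne _ _ _ (by simp only [hp']; omega),
          entry_update_of_ne _ _ _ (by simp only [hp]; omega)]
      have e5 : ∏ i ∈ Finset.Icc 1 k, stageFactor q α (update₂ s p p' x z) y i =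
          ∏ i ∈ Finset.Icc 1 k, stageFactor q α s y i := by
        refine Finset.prod_congr rfl fun i hi => ?_
        rw [Finset.mem_Icc] at hi
        exact stageFactor_update₂ _ _ _ _ hi.1 (by simp only [hp]; omega) (by simp only [hp']; omega)
      rw [ih (by omega), e1, e2, e5]
      congr 1
      refine propext (and_congr_right fun _ => ?_)
      constructor
      · rintro ⟨h3, h4⟩
        exact ⟨fun j hj => by rw [← e4 j hj, h3 j (by omega)], by rw [← h3 _ le_rfl, e3], h4⟩
      · rintro ⟨h3, h3', h4⟩
        refine ⟨fun j hj => ?_, h4⟩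
        rcases hj.eq_or_lt with rfl | hj
        · rw [e3, h3']
        · rw [e4 j hj, h3 j hj]
    have hst : stage q α (k + 1) = couple q p p' (stageType α k) (fun _ => α p') (stage q α k) :=
      stage_succ hk
    rw [hst, repr_couple]
    simp only [hterm]
    rw [Finset.prod_Icc_succ_top (by omega)]
    by_cases hC : entry s 1 = entry y 1 ∧ (∀ j, k + 4 ≤ j → entry s j = entry y j) ∧
        psum s 2 (k + 1 + 2) = psum y 2 (k + 1 + 2)
    · rw [if_pos hC]
      obtain ⟨hC1, hC2, hC3⟩ := hC
      rcases le_or_gt P (psum y 2 (k + 2)) with hle | hlt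
      · obtain ⟨x, hx⟩ := Nat.exists_eq_add_of_le hle
        rw [Finset.sum_eq_single (x, entry y (k + 3))]
        · rw [if_pos ⟨hC1, hC2, rfl, hx.symm⟩, mul_comm, Complex.ofReal_mul]
          congr 2
          unfold stageFactor
          rw [show k + 1 + 1 = (p : ℕ) + 1 from rfl, entry_val_succ,
            show k + 1 + 2 = (p' : ℕ) + 1 from rfl, entry_val_succ, ← hP, Nat.add_sub_cancel]
          congr 1
          · rw [show (p : ℕ) + 1 = k + 2 from rfl, hx]; push_cast; ring
          · exact (entry_val_succ α p').symm
          · rw [show (p' : ℕ) + 1 = k + 1 + 2 from rfl, ← hC3, hsP]; push_cast; ring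
        · rintro ⟨x', z'⟩ - hne
          rw [if_neg, mul_zero]
          rintro ⟨-, -, h3, h4⟩
          simp only at h3 h4
          exact hne (Prod.ext (by simp only; omega) h3)
        · intro hn
          refine absurd (mem_antidiagonal.2 ?_) hn
          simp only
          omega
      -- Here no term survives, and the product vanishes too because the first argument of the new
      -- `qHahnHat` is negative.
      · rw [Finset.sum_eq_zero]
        · have : stageFactor q α s y (k + 1) = 0 := by
            refine qHahnHat_eq_zero_of_neg ?_
            rw [← hP, show k + 1 + 1 = k + 2 from rfl]
            omega
          rw [this, mul_zero, Complex.ofReal_zero]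
        · rintro x -
          rw [if_neg (by rintro ⟨-, -, -, h4⟩; omega), mul_zero]
    · rw [if_neg hC]
      refine Finset.sum_eq_zero fun x hx => ?_
      have hx := mem_antidiagonal.1 hx
      rw [if_neg, mul_zero]
      rintro ⟨h1, h2, h3, h4⟩
      exact hC ⟨h1, h2, by omega⟩

end

/-! ### The coupled basis -/

section
variable {D : ℕ} {q : ℝ} {α : Fin (D + 2) → ℝ}

/-- The labels of the coupled basis in the order produced by the successive couplings:
`(m_{d-1}, m_1, …, m_{d-2}, m_d)`. -/
def rotate (m : Fin (D + 2) → ℕ) (l : Fin (D + 2)) : ℕ :=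
  if l = 0 then entry m (D + 1) else if l = Fin.last (D + 1) then entry m (D + 2) else entry m l

theorem rotate_zero (m : Fin (D + 2) → ℕ) : rotate m 0 = entry m (D + 1) := if_pos rfl

theorem rotate_last (m : Fin (D + 2) → ℕ) : rotate m (Fin.last (D + 1)) = entry m (D + 2) := by
  rw [rotate, if_neg (by simp [Fin.ext_iff]), if_pos rfl]

theorem entry_rotate (m : Fin (D + 2) → ℕ) {j : ℕ} (hj : 1 ≤ j) (hjD : j ≤ D) :
    entry (rotate m) (j + 1) = entry m j := by
  have h := entry_val_succ (rotate m) ⟨j, by omega⟩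
  simp only at h
  rw [h, rotate, if_neg (by simp [Fin.ext_iff]; omega), if_neg (by simp [Fin.ext_iff]; omega)]

theorem psum_rotate (m : Fin (D + 2) → ℕ) {j : ℕ} (hj : j ≤ D) :
    psum (rotate m) 2 (j + 1) = psum m 1 j := by
  induction j with
  | zero => rw [psum_of_lt _ (by omega), psum_of_lt _ (by omega)]
  | succ j ih =>
    rw [psum_succ _ (by omega), ih (by omega), psum_succ _ (by omega),
      entry_rotate m (by omega) hj]

theorem rotate_injective : Function.Injective (rotate (D := D)) := by
  intro m m' h
  refine ext_entry fun k hk hkd => ?_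
  rcases (show k = D + 1 ∨ k = D + 2 ∨ k ≤ D by omega) with rfl | rfl | hkD
  · rw [← rotate_zero, h, rotate_zero]
  · rw [← rotate_last, h, rotate_last]
  · rw [← entry_rotate m hk hkD, h, entry_rotate m' hk hkD]

/-- The coupled basis. -/
def coupled (q : ℝ) (α : Fin (D + 2) → ℝ) (m : Fin (D + 2) → ℕ) : W (D + 2) :=
  couple q 0 (Fin.last (D + 1)) (fun _ => α 0) (stageType α D) (stage q α D) (rotate m)

theorem zero_ne_last : (0 : Fin (D + 2)) ≠ Fin.last (D + 1) := by simp [Fin.ext_iff]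

theorem coupled_ladder (hq0 : 0 < q) (hq1 : q < 1) (hα : ∀ k, 0 < α k) :
    Ladder q (qA0Set q 1 α (interval (D + 2) 1 (D + 2)))
      (qA0Set q (-1) α (interval (D + 2) 1 (D + 2))) (AplusSet q α 1 (D + 2))
      (AminusSet q α 1 (D + 2)) (Fin.last (D + 1))
      (fun s => α 0 + stageType α D s + 1 + 2 * ((s 0 : ℕ) : ℝ))
      (couple q 0 (Fin.last (D + 1)) (fun _ => α 0) (stageType α D) (stage q α D)) := by
  have h₁ := stage_site_ladder (q := q) (α := α) (k := D) (by omega) 0 (Or.inl rfl)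
  have h₂ := stage_ladder hq0 hq1 hα (k := D) (by omega)
  have h := h₁.couple hq0 hq1 zero_ne_last h₂ (fun _ => hα _) (stageType_pos hα (by omega))
    (indepAt_const _ _) (indepAt_const _ _) (stageType_indep _ _ _ (by simp))
    (stageType_indep _ _ _ (by simp))
  convert h using 1
  · exact qA0Set_interval_one q 1 α 0 rfl (by omega)
  · exact qA0Set_interval_one q (-1) α 0 rfl (by omega)
  · exact twistedSum_one q α (fun k => site k (Aplus q (α k))) 0 rfl (by omega)
  · exact twistedSum_one q α (fun k => site k (Aminus q (α k))) 0 rfl (by omega)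

theorem stageType_rotate (m : Fin (D + 2) → ℕ) {j : ℕ} (hj : j ≤ D) :
    stageType α j (rotate m) = 2 * ((psum m 1 j : ℕ) : ℝ) + psum α 2 (j + 2) + j := by
  rw [stageType, psum_rotate m hj]

theorem coupledType_rotate (m : Fin (D + 2) → ℕ) :
    α 0 + stageType α D (rotate m) + 1 + 2 * ((rotate m 0 : ℕ) : ℝ) =
      2 * ((psum m 1 (D + 1) : ℕ) : ℝ) + psum α 1 (D + 2) + (D + 2 : ℕ) - 1 := by
  rw [stageType_rotate m le_rfl, rotate_zero, psum_succ m (by omega), psum_one_eq α (by omega),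
    ← entry_val_succ α 0, Fin.val_zero, zero_add]
  push_cast
  ring

theorem coupled_jointEigen (hq0 : 0 < q) (hq1 : q < 1) (hα : ∀ k, 0 < α k)
    (m : Fin (D + 2) → ℕ) : JointEigen q α m (coupled q α m) where
  intermediate k hk hkd := by
    obtain ⟨j, rfl⟩ := Nat.exists_eq_add_of_le' (show 2 ≤ k by omega)
    have hind : ∀ p : Fin (D + 2), (p : ℕ) = 0 ∨ j + 1 ≤ p →
        IndepAt (fun s => ((gamma q (stageType α j s) : ℝ) : ℂ)) p := by
      intro p hp s v
      beta_reduce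
      rw [stageType_indep α j p hp]
    have h := couple_eigen (q := q) (p := 0) (p' := Fin.last (D + 1)) (a := fun _ => α 0)
      (b := stageType α D) (F := stage q α D) (Z := Casimir q α 2 (j + 2))
      (c := fun s => ((gamma q (stageType α j s) : ℝ) : ℂ))
      (stage_casimir hq0 hq1 hα (by omega) (by omega)) (hind 0 (Or.inl rfl))
      (hind _ (Or.inr (by simp; omega))) (rotate m)
    rw [stageType_rotate m (by omega)] at h
    rw [coupled, h, Nat.add_sub_cancel]
    congr 3
    push_cast
    ring
  full := by
    have hpos : ∀ s : Fin (D + 2) → ℕ, 0 < α 0 + stageType α D s + 1 + 2 * ((s 0 : ℕ) : ℝ) := by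
      intro s
      have h1 := hα 0
      have h2 := stageType_pos hα (k := D) le_rfl s
      positivity
    have h := (coupled_ladder hq0 hq1 hα).casimir hq0 hq1 (fun s v => by
      beta_reduce
      rw [stageType_indep α D _ (by simp), Function.update_of_ne zero_ne_last]) hpos (rotate m)
    rw [coupledType_rotate] at h
    exact h
  weight := by
    have h := (coupled_ladder hq0 hq1 hα).weight (rotate m)
    rw [coupledType_rotate, rotate_last] at h
    rw [coupled, h, psum_succ m (show 1 ≤ D + 1 + 1 by omega)]
    congr 3
    push_cast
    ring

theorem coupled_orthonormal (hq0 : 0 < q) (hq1 : q < 1) (hα : ∀ k, 0 < α k) :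
    IsOrthonormal (coupled q α) := by
  intro m m'
  have h := (stage_orthonormal hq0 hq1 hα (k := D) (by omega)).couple hq0 hq1 zero_ne_last
    (fun _ => hα 0) (stageType_pos hα le_rfl) (indepAt_const _ _) (indepAt_const _ _)
    (stageType_indep _ _ _ (by simp)) (stageType_indep _ _ _ (by simp)) (rotate m) (rotate m')
  rw [coupled, coupled, h]
  simp only [rotate_injective.eq_iff]

theorem Xi_eq (m y : Fin (D + 2) → ℕ) :
    Xi q α m y = (if psum m 1 (D + 2) = psum y 1 (D + 2) then 1 else 0) *
      (∏ i ∈ Finset.Icc 1 D, stageFactor q α (rotate m) y i) *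
      qHahnHat q (entry m (D + 1)) ((entry y 1 : ℕ) : ℤ) (α 0) (stageType α D (rotate m))
        ((psum y 1 (D + 2) : ℕ) - (psum m 1 D : ℕ)) := by
  unfold Xi
  simp only
  rw [Nat.add_sub_cancel, show D + 2 - 1 = D + 1 by omega]
  congr 1
  · congr 1
    refine Finset.prod_congr rfl fun i hi => ?_
    rw [Finset.mem_Icc] at hi
    obtain ⟨j, rfl⟩ := Nat.exists_eq_add_of_le' hi.1
    rw [stageFactor, entry_rotate m (by omega) hi.2, psum_rotate m (by omega),
      stageType_rotate m (by omega), Nat.add_sub_cancel]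
    congr 1
    push_cast
    ring
  · rw [stageType_rotate m le_rfl, ← entry_val_succ α 0]
    congr 1
    push_cast
    ring

theorem repr_coupled (m y : Fin (D + 2) → ℕ) :
    (e (D + 2)).repr (coupled q α m) y = (Xi q α m y : ℂ) := by
  classical
  have hM : psum m 1 (D + 2) = psum m 1 D + entry m (D + 1) + entry m (D + 2) := by
    rw [psum_succ _ (by omega), psum_succ _ (by omega)]
  have hY := psum_one_eq y (show 1 ≤ D + 2 by omega)
  have hterm : ∀ x z : ℕ,
      (e (D + 2)).repr (stage q α D (update₂ (rotate m) 0 (Fin.last (D + 1)) x z)) y =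
      if x = entry y 1 ∧ psum m 1 D + z = psum y 2 (D + 2) then
        ((∏ i ∈ Finset.Icc 1 D, stageFactor q α (rotate m) y i : ℝ) : ℂ) else 0 := by
    intro x z
    have e1 : entry (update₂ (rotate m) 0 (Fin.last (D + 1)) x z) 1 = x := by
      rw [update₂, entry_update_of_ne _ _ _ (by simp)]
      exact entry_update_self _ _ _
    have e2 : psum (update₂ (rotate m) 0 (Fin.last (D + 1)) x z) 2 (D + 2) = psum m 1 D + z := by
      rw [psum_succ _ (by omega)]
      congr 1
      · rw [update₂, psum_update _ _ _ (by simp), psum_update _ _ _ (by simp),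
          psum_rotate m le_rfl]
      · exact entry_update_self _ _ _
    have e5 : ∏ i ∈ Finset.Icc 1 D,
        stageFactor q α (update₂ (rotate m) 0 (Fin.last (D + 1)) x z) y i =
        ∏ i ∈ Finset.Icc 1 D, stageFactor q α (rotate m) y i := by
      refine Finset.prod_congr rfl fun i hi => ?_
      rw [Finset.mem_Icc] at hi
      exact stageFactor_update₂ _ _ _ _ hi.1 (Or.inl rfl) (by simp; omega)
    rw [repr_stage (by omega), e1, e2, e5]
    congr 1
    refine propext (and_congr_right fun _ => and_iff_right fun j hj => ?_)
    rw [entry_of_lt _ (by omega), entry_of_lt _ (by omega)]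
  rw [coupled, repr_couple, Xi_eq]
  simp only [hterm, rotate_zero, rotate_last]
  by_cases hC : psum m 1 (D + 2) = psum y 1 (D + 2)
  · rw [if_pos hC, one_mul]
    rcases le_or_gt (psum m 1 D) (psum y 2 (D + 2)) with hle | hlt
    · obtain ⟨z, hz⟩ := Nat.exists_eq_add_of_le hle
      rw [Finset.sum_eq_single (entry y 1, z)]
      · rw [if_pos ⟨rfl, hz.symm⟩, mul_comm, Complex.ofReal_mul]
        congr 3
        rw [← hC, hM]
        push_cast
        ring
      · rintro ⟨x', z'⟩ - hne
        rw [if_neg, mul_zero]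
        rintro ⟨h1, h2⟩
        simp only at h1 h2
        exact hne (Prod.ext h1 (by simp only; omega))
      · intro hn
        refine absurd (mem_antidiagonal.2 ?_) hn
        simp only
        omega
    -- No level `z` is admissible, and correspondingly `y_1` exceeds `Y_d - M_{d-2}`, outside the
    -- support of the last `qHahnHat`.
    · rw [qHahnHat_eq_zero_of_gt (by omega), mul_zero, Complex.ofReal_zero]
      refine Finset.sum_eq_zero fun x hx => ?_
      rw [if_neg (by omega), mul_zero]
  · rw [if_neg hC, zero_mul, zero_mul, Complex.ofReal_zero]
    refine Finset.sum_eq_zero fun x hx => ?_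
    have hx := mem_antidiagonal.1 hx
    rw [if_neg (by omega), mul_zero]

/-! ### Orthogonality relations and expansions -/

/-- The finite set of multi-indices of total degree `N`. -/
def level (D N : ℕ) : Finset (Fin (D + 2) → ℕ) := Finset.piAntidiag Finset.univ N

theorem mem_level {N : ℕ} {y : Fin (D + 2) → ℕ} : y ∈ level D N ↔ psum y 1 (D + 2) = N := by
  simp [level, sum_eq_psum]

theorem psum_eq_of_Xi_ne_zero {m y : Fin (D + 2) → ℕ} (h : Xi q α m y ≠ 0) :
    psum m 1 (D + 2) = psum y 1 (D + 2) := by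
  by_contra hne
  rw [Xi_eq, if_neg hne, zero_mul, zero_mul] at h
  exact h rfl

theorem Xi_support_right (m : Fin (D + 2) → ℕ) :
    {y | Xi q α m y ≠ 0} ⊆ (level D (psum m 1 (D + 2)) : Set (Fin (D + 2) → ℕ)) :=
  fun _ h => Finset.mem_coe.2 (mem_level.2 (psum_eq_of_Xi_ne_zero h).symm)

theorem Xi_support_left (y : Fin (D + 2) → ℕ) :
    {m | Xi q α m y ≠ 0} ⊆ (level D (psum y 1 (D + 2)) : Set (Fin (D + 2) → ℕ)) :=
  fun _ h => Finset.mem_coe.2 (mem_level.2 (psum_eq_of_Xi_ne_zero h))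

theorem coupled_eq_sum (m : Fin (D + 2) → ℕ) {N : ℕ} (hm : psum m 1 (D + 2) = N) :
    coupled q α m = ∑ y ∈ level D N, (Xi q α m y : ℂ) • e (D + 2) y := by
  have h := (e (D + 2)).linearCombination_repr (coupled q α m)
  rw [Finsupp.linearCombination_apply, Finsupp.sum_of_support_subset _ (s := level D N)] at h
  · rw [← h]
    exact Finset.sum_congr rfl fun y _ => by rw [repr_coupled]
  · intro y hy
    rw [Finsupp.mem_support_iff, repr_coupled, Complex.ofReal_ne_zero] at hy
    rw [← hm]
    exact Xi_support_right m hy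
  · simp

theorem sum_Xi_mul_row (hq0 : 0 < q) (hq1 : q < 1) (hα : ∀ k, 0 < α k)
    (m m' : Fin (D + 2) → ℕ) {N : ℕ} (hm : psum m 1 (D + 2) = N) :
    ∑ y ∈ level D N, Xi q α m y * Xi q α m' y = if m = m' then 1 else 0 := by
  have h := coupled_orthonormal hq0 hq1 hα m m'
  rw [coupled_eq_sum m hm, ip_sum_left] at h
  simp only [ip_e_left, repr_coupled, Complex.conj_ofReal] at h
  split_ifs at h ⊢ <;> exact_mod_cast h

/-- On a fixed total degree, `m` and `y` run over the same finite set, so the row relations make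
`Xi` a square matrix with a right inverse, which is also a left inverse. Different total degrees do
not interact. -/
theorem sum_Xi_mul_col (hq0 : 0 < q) (hq1 : q < 1) (hα : ∀ k, 0 < α k)
    (y y' : Fin (D + 2) → ℕ) {N : ℕ} (hy : psum y 1 (D + 2) = N) :
    ∑ m ∈ level D N, Xi q α m y * Xi q α m y' = if y = y' then 1 else 0 := by
  by_cases hy' : psum y' 1 (D + 2) = N
  · let X : Matrix (level D N) (level D N) ℝ := Matrix.of fun m y => Xi q α m y
    have hX : X * X.transpose = 1 := by
      ext m m'
      rw [Matrix.mul_apply, Matrix.one_apply]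
      simp only [Matrix.transpose_apply, X, Matrix.of_apply]
      rw [Finset.sum_coe_sort (level D N) fun y => Xi q α m y * Xi q α m' y,
        sum_Xi_mul_row hq0 hq1 hα _ _ (mem_level.1 m.2)]
      simp only [Subtype.ext_iff]
    have hX1 : X.transpose * X = 1 := mul_eq_one_comm.1 hX
    have hX' := congrFun (congrFun hX1 ⟨y, mem_level.2 hy⟩)
      ⟨y', mem_level.2 hy'⟩
    rw [Matrix.mul_apply, Matrix.one_apply] at hX'
    simp only [Matrix.transpose_apply, X, Matrix.of_apply] at hX'
    rw [Finset.sum_coe_sort (level D N) fun m => Xi q α m y * Xi q α m y'] at hX'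
    rw [hX']
    simp only [Subtype.mk.injEq]
  · rw [if_neg (by rintro rfl; exact hy' hy)]
    refine Finset.sum_eq_zero fun m hm => ?_
    have : Xi q α m y' = 0 := by
      by_contra h
      exact hy' ((psum_eq_of_Xi_ne_zero h).symm.trans (mem_level.1 hm))
    rw [this, mul_zero]

theorem e_eq_sum (hq0 : 0 < q) (hq1 : q < 1) (hα : ∀ k, 0 < α k) (y : Fin (D + 2) → ℕ) {N : ℕ}
    (hy : psum y 1 (D + 2) = N) :
    e (D + 2) y = ∑ m ∈ level D N, (Xi q α m y : ℂ) • coupled q α m := by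
  have h1 : ∀ m ∈ level D N, (Xi q α m y : ℂ) • coupled q α m =
      ∑ y' ∈ level D N, ((Xi q α m y * Xi q α m y' : ℝ) : ℂ) • e (D + 2) y' := by
    intro m hm
    rw [coupled_eq_sum m (mem_level.1 hm), Finset.smul_sum]
    exact Finset.sum_congr rfl fun y' _ => by rw [smul_smul, Complex.ofReal_mul]
  rw [Finset.sum_congr rfl h1, Finset.sum_comm]
  simp only [← Finset.sum_smul, ← Complex.ofReal_sum]
  rw [Finset.sum_eq_single y]
  · rw [sum_Xi_mul_col hq0 hq1 hα y y hy, if_pos rfl, Complex.ofReal_one, one_smul]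
  · intro y' _ hne
    rw [sum_Xi_mul_col hq0 hq1 hα y y' hy, if_neg hne.symm, Complex.ofReal_zero, zero_smul]
  · intro h
    exact absurd (mem_level.2 hy) h

theorem span_coupled (hq0 : 0 < q) (hq1 : q < 1) (hα : ∀ k, 0 < α k) :
    Submodule.span ℂ (Set.range (coupled q α)) = ⊤ := by
  rw [eq_top_iff, ← (e (D + 2)).span_eq, Submodule.span_le]
  rintro _ ⟨y, rfl⟩
  rw [SetLike.mem_coe, e_eq_sum hq0 hq1 hα y rfl]
  exact Submodule.sum_mem _ fun m _ =>
    Submodule.smul_mem _ _ (Submodule.subset_span (Set.mem_range_self m))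

theorem isCoupledBasis_coupled (hq0 : 0 < q) (hq1 : q < 1) (hα : ∀ k, 0 < α k) :
    IsCoupledBasis q α (coupled q α) where
  orthonormal := coupled_orthonormal hq0 hq1 hα
  span := span_coupled hq0 hq1 hα
  eigen := coupled_jointEigen hq0 hq1 hα

end

/-! ### Uniqueness -/

theorem gamma_inj {q : ℝ} (hq0 : 0 < q) (hq1 : q < 1) {a b : ℝ} (ha : 0 < a) (hb : 0 < b)
    (h : gamma q a = gamma q b) : a = b := by
  have hD : (q ^ (1 / 2 : ℝ) - q ^ (-1 / 2 : ℝ)) ^ 2 ≠ 0 := by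
    have : q ^ (1 / 2 : ℝ) < q ^ (-1 / 2 : ℝ) :=
      Real.rpow_lt_rpow_of_exponent_gt hq0 hq1 (by norm_num)
    exact pow_ne_zero 2 (by linarith)
  rw [gamma, gamma, div_left_inj' hD, neg_div, neg_div, Real.rpow_neg hq0.le,
    Real.rpow_neg hq0.le] at h
  have ha0 : 0 < q ^ (a / 2) := Real.rpow_pos_of_pos hq0 _
  have hb0 : 0 < q ^ (b / 2) := Real.rpow_pos_of_pos hq0 _
  have ha1 : q ^ (a / 2) < 1 := Real.rpow_lt_one hq0.le hq1 (by linarith)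
  have hb1 : q ^ (b / 2) < 1 := Real.rpow_lt_one hq0.le hq1 (by linarith)
  have hab : q ^ (a / 2) = q ^ (b / 2) := by
    generalize q ^ (a / 2) = u at *
    generalize q ^ (b / 2) = v at *
    -- The function `u + 1/u` takes equal values only at `u = v` or `u v = 1`, and the latter is
    -- impossible in `(0,1)`.
    have h1 : (u - v) * (1 - u * v) = 0 := by
      field_simp at h
      linear_combination -h
    rcases mul_eq_zero.1 h1 with h2 | h2
    · linarith
    · nlinarith
  have := Real.rpow_right_inj hq0 hq1.ne |>.1 hab
  linarith

section
variable {d : ℕ} {q : ℝ} {α : Fin d → ℝ}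

/-- Pairing the eigenvalue equation with `u m` isolates `c m * f m = l * f m`. Only the diagonal
action of `T` on the orthonormal family is needed, not self-adjointness. -/
theorem eigenvalue_eq {u : (Fin d → ℕ) → W d} (hu : IsOrthonormal u)
    {T : Module.End ℂ (W d)} {c : (Fin d → ℕ) → ℝ} (hT : ∀ m, T (u m) = (c m : ℂ) • u m)
    (f : (Fin d → ℕ) →₀ ℂ) {l : ℝ}
    (hw : T (f.sum fun m x => x • u m) = (l : ℂ) • f.sum fun m x => x • u m)
    {m : Fin d → ℕ} (hm : f m ≠ 0) : c m = l := by
  have hu : ∀ s s', ip (u s) (u s') = if s = s' then 1 else 0 := hu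
  have h := congrArg (ip (u m)) hw
  rw [Finsupp.sum, map_sum, ip_smul_right, ip_sum_right] at h
  simp only [map_smul, hT] at h
  rw [ip_sum_right] at h
  simp only [ip_smul_right, hu, mul_ite, mul_one, mul_zero, Finset.sum_ite_eq] at h
  rw [if_pos (Finsupp.mem_support_iff.2 hm), if_pos (Finsupp.mem_support_iff.2 hm), mul_comm] at h
  exact_mod_cast mul_right_cancel₀ hm h

/-- The Casimir of `[2;j+2]` yields `M_j` for `1 ≤ j ≤ d - 2`, that of `[1;d]` yields `M_{d-1}`, and
the weight yields `M_d`; successive differences give `m`. All types are positive, as `gamma_inj`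
requires. -/
theorem eq_of_jointEigenvalues (hq0 : 0 < q) (hq1 : q < 1) (hd : 2 ≤ d) (hα : ∀ k, 0 < α k)
    {m m' : Fin d → ℕ}
    (h₁ : ∀ k : ℕ, 3 ≤ k → k ≤ d →
      gamma q (2 * ((psum m 1 (k - 2) : ℕ) : ℝ) + psum α 2 k + k - 2) =
      gamma q (2 * ((psum m' 1 (k - 2) : ℕ) : ℝ) + psum α 2 k + k - 2))
    (h₂ : gamma q (2 * ((psum m 1 (d - 1) : ℕ) : ℝ) + psum α 1 d + d - 1) =
      gamma q (2 * ((psum m' 1 (d - 1) : ℕ) : ℝ) + psum α 1 d + d - 1))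
    (h₃ : q ^ (((psum m 1 d : ℕ) : ℝ) + (psum α 1 d + d) / 2) =
      q ^ (((psum m' 1 d : ℕ) : ℝ) + (psum α 1 d + d) / 2)) : m = m' := by
  have hd' : (2 : ℝ) ≤ d := by exact_mod_cast hd
  have hsum : ∀ j, j ≤ d → psum m 1 j = psum m' 1 j := by
    intro j hj
    rcases (show j = 0 ∨ (1 ≤ j ∧ j + 2 ≤ d) ∨ j = d - 1 ∨ j = d by omega) with
      rfl | ⟨hj1, hj2⟩ | rfl | rfl
    · rw [psum_of_lt _ (by omega), psum_of_lt _ (by omega)]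
    · have h := h₁ (j + 2) (by omega) hj2
      have hp := psum_pos hα (i := 2) (j := j + 2) (by omega) (by omega) hj2
      rw [Nat.add_sub_cancel] at h
      have := gamma_inj hq0 hq1 (by push_cast; linarith [Nat.cast_nonneg (α := ℝ) (psum m 1 j), Nat.cast_nonneg (α := ℝ) j])
        (by push_cast; linarith [Nat.cast_nonneg (α := ℝ) (psum m' 1 j), Nat.cast_nonneg (α := ℝ) j]) h
      have h' : ((psum m 1 j : ℕ) : ℝ) = (psum m' 1 j : ℕ) := by linarith
      exact_mod_cast h'
    · have hp := psum_pos hα (i := 1) (j := d) (by omega) (by omega) le_rfl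
      have := gamma_inj hq0 hq1 (by linarith [Nat.cast_nonneg (α := ℝ) (psum m 1 (d - 1))])
        (by linarith [Nat.cast_nonneg (α := ℝ) (psum m' 1 (d - 1))]) h₂
      have h' : ((psum m 1 (d - 1) : ℕ) : ℝ) = (psum m' 1 (d - 1) : ℕ) := by linarith
      exact_mod_cast h'
    · have := Real.rpow_right_inj hq0 hq1.ne |>.1 h₃
      have h' : ((psum m 1 j : ℕ) : ℝ) = (psum m' 1 j : ℕ) := by linarith
      exact_mod_cast h'
  refine ext_entry fun k hk hkd => ?_
  obtain ⟨j, rfl⟩ := Nat.exists_eq_add_of_le' hk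
  have h1 := hsum (j + 1) hkd
  rw [psum_succ m (by omega), psum_succ m' (by omega), hsum j (by omega)] at h1
  omega

theorem IsCoupledBasis.unique (hq0 : 0 < q) (hq1 : q < 1) (hd : 2 ≤ d) (hα : ∀ k, 0 < α k)
    {u u' : (Fin d → ℕ) → W d} (hu : IsCoupledBasis q α u) (hu' : IsCoupledBasis q α u')
    (m : Fin d → ℕ) : ∃ ε : ℂ, ‖ε‖ = 1 ∧ u' m = ε • u m := by
  have hmem : u' m ∈ Submodule.span ℂ (Set.range u) := by rw [hu.span]; trivial
  obtain ⟨f, hf⟩ := Finsupp.mem_span_range_iff_exists_finsupp.1 hmem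
  have he := hu'.eigen m
  rw [← hf] at he
  -- A component of `u' m` along `u m'` would force the joint eigenvalues of `m'` and `m` to
  -- coincide.
  have hzero : ∀ m', m' ≠ m → f m' = 0 := by
    intro m' hne
    by_contra h0
    refine hne (eq_of_jointEigenvalues hq0 hq1 hd hα ?_ ?_ ?_)
    · intro k hk hkd
      exact eigenvalue_eq hu.orthonormal (fun m => (hu.eigen m).intermediate k hk hkd) f
        (he.intermediate k hk hkd) h0
    · exact eigenvalue_eq hu.orthonormal (fun m => (hu.eigen m).full) f he.full h0
    · exact eigenvalue_eq hu.orthonormal (fun m => (hu.eigen m).weight) f he.weight h0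
  have hf' : u' m = f m • u m := by
    rw [← hf, Finsupp.sum, Finset.sum_eq_single m]
    · intro m' _ hne
      rw [hzero m' hne, zero_smul]
    · intro h
      rw [Finsupp.notMem_support_iff.1 h, zero_smul]
  refine ⟨f m, ?_, hf'⟩
  have h1 := hu'.orthonormal m m
  rw [hf', ip_smul_left, ip_smul_right, hu.orthonormal, if_pos rfl, mul_one,
    Complex.conj_mul'] at h1
  have h2 : ‖f m‖ ^ 2 = 1 := by exact_mod_cast h1
  exact (pow_eq_one_iff_of_nonneg (norm_nonneg _) two_ne_zero).1 h2

end

end SUq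

end

theorem proposition2 (q : ℝ) (hq0 : 0 < q) (hq1 : q < 1) (d : ℕ) (hd : 2 ≤ d)
    (α : Fin d → ℝ) (hα : ∀ k, 0 < α k) :
    -- all the sums below are finite
    (∀ m : Fin d → ℕ, {y : Fin d → ℕ | SUq.Xi q α m y ≠ 0}.Finite) ∧
    (∀ y : Fin d → ℕ, {m : Fin d → ℕ | SUq.Xi q α m y ≠ 0}.Finite) ∧
    -- the two orthogonality relations
    (∀ m m' : Fin d → ℕ,
      ∑ᶠ y : Fin d → ℕ, SUq.Xi q α m y * SUq.Xi q α m' y = if m = m' then 1 else 0) ∧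
    (∀ y y' : Fin d → ℕ,
      ∑ᶠ m : Fin d → ℕ, SUq.Xi q α m y * SUq.Xi q α m y' = if y = y' then 1 else 0) ∧
    -- the coupled basis and the two expansion formulas
    ∃ u : (Fin d → ℕ) → SUq.W d,
      SUq.IsCoupledBasis q α u ∧
      (∀ m : Fin d → ℕ, u m = ∑ᶠ y : Fin d → ℕ, (SUq.Xi q α m y : ℂ) • SUq.e d y) ∧
      (∀ y : Fin d → ℕ, SUq.e d y = ∑ᶠ m : Fin d → ℕ, (SUq.Xi q α m y : ℂ) • u m) ∧
      -- the eigenvalue equations determine the basis up to phases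
      (∀ u' : (Fin d → ℕ) → SUq.W d, SUq.IsCoupledBasis q α u' →
        ∀ m : Fin d → ℕ, ∃ ε : ℂ, ‖ε‖ = 1 ∧ u' m = ε • u m) := by
  obtain ⟨D, rfl⟩ := Nat.exists_eq_add_of_le' hd
  refine ⟨fun m => (Finset.finite_toSet _).subset (SUq.Xi_support_right m),
    fun y => (Finset.finite_toSet _).subset (SUq.Xi_support_left y), fun m m' => ?_, fun y y' => ?_,
    SUq.coupled q α, SUq.isCoupledBasis_coupled hq0 hq1 hα, fun m => ?_, fun y => ?_,
    fun u' hu' m => (SUq.isCoupledBasis_coupled hq0 hq1 hα).unique hq0 hq1 hd hα hu' m⟩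
  · rw [← SUq.sum_Xi_mul_row hq0 hq1 hα m m' rfl]
    -- The support lies in one level set, so the `finsum` is a genuine finite sum rather than its
    -- default value `0`.
    exact finsum_eq_sum_of_support_subset _ fun y hy =>
      SUq.Xi_support_right m (left_ne_zero_of_mul hy)
  · rw [← SUq.sum_Xi_mul_col hq0 hq1 hα y y' rfl]
    exact finsum_eq_sum_of_support_subset _ fun m hm =>
      SUq.Xi_support_left y (left_ne_zero_of_mul hm)
  · rw [SUq.coupled_eq_sum m rfl]
    refine (finsum_eq_sum_of_support_subset _ fun y hy => SUq.Xi_support_right (q := q) (α := α) m ?_).symm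
    rintro (h : SUq.Xi q α m y = 0)
    exact hy (by simp only [h, Complex.ofReal_zero, zero_smul])
  · rw [SUq.e_eq_sum hq0 hq1 hα y rfl]
    refine (finsum_eq_sum_of_support_subset _ fun m hm => SUq.Xi_support_left (q := q) (α := α) y ?_).symm
    rintro (h : SUq.Xi q α m y = 0)
    exact hm (by simp only [h, Complex.ofReal_zero, zero_smul])
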